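/- **Setting.** In sorting with uncertainty (uniform query costs, error threshold $\delta$) an algorithm is given intervals $I_i=[\ell_i,r_i]$, $i=1,\dots,n$, containing unknown reals $v_i\in I_i$; querying $I_i$ reveals $v_i$ and replaces $I_i$ by $[v_i,v_i]$. A set $Q$ of queries is *sufficient* if there is a permutation $\pi$ such that, for every vector $u$ of values consistent with the intervals and with the answers to the queries in $Q$, $\pi(i)<\pi(j)$ implies $u_i\le u_j+\delta$. Let $\mathrm{opt}$ be the minimum size of a sufficient set for the actual values $v$. A deterministic adaptive algorithm must, for all intervals and all values, make a finite number of queries, each depending only on the intervals and on the previous answers, that form a sufficient set; it is $c$-query-competitive on a class of instances if it makes at most $c\cdot\mathrm{opt}$ queries on each of them. Two intervals are *dependent* if $r_i-\ell_j>\delta$ and $r_j-\ell_i>\delta$ (always for the current intervals); this defines the dependency graph. A *2-component* is a connected component consisting of a single edge. Write $I\supset[a,b]$ if $I=[\ell,r]$ with $\ell<a$ and $b<r$. **Algorithm 1** (parameter $p$). *Preprocessing loop:* while there are $i,j$ with $I_i\supset[\ell_j-\delta,r_j+\delta]$, or $I_i\supset[v_j-\delta,v_j+\delta]$ with $v_j$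 already revealed, query $I_i$. *Main loop:* while there is some dependency, do the following. - If some component is an edge $ij$, pick $i$ with probability $p$ and $j$ with probability $1-p$; query the picked interval, say $I_i$; if $I_j\supset[v_i-\delta,v_i+\delta]$, query $I_j$. - Otherwise, let $x$ be a non-isolated vertex with minimum $r_x$, $y$ a neighbor of $x$ with minimum $r_y$, and $z$ another neighbor of $x$ (or of $y$, if $y$ is the only neighbor of $x$) with minimum $r_z$. Query $I_y$; if then $I_x\supset[v_y-\delta,v_y+\delta]$ or $I_x,I_z$ are dependent, query $I_x$ and $I_z$. - In either case, then, while $I_i\supset[v_j-\delta,v_j+\delta]$ for some $i$ and some revealed $v_j$, query $I_i$. All choices left open (the next interval in a loop, the edge component and the names $i,j$ of its ends, ties between minima) may be made arbitrarily. **Theorem.** Let $\delta=0$. 1. For $p\in\{0,1\}$, every execution of Algorithm 1 terminates, whatever the answers and the open choices are; Algorithm 1, with any way of making the open choices, is a deterministic adaptive algorithm for the problem, and it is $5/3$-query-competitive on the instances whose dependency graph has no 2-components after the preprocessing loop. 2. Conversely, if a deterministic adaptive algorithm is $c$-query-competitive on the instances whose dependency graph is a proper interval graph with no 2-components, then $c\ge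 5/3$. This holds even if, moreover, there are no 2-components after the preprocessing loop of Algorithm 1. -/

import Mathlib

/-! Sorting with uncertainty, uniform query costs. -/

noncomputable section

namespace UncertainSorting

/-- The uncertainty intervals `[lo i, hi i]` given to an algorithm. -/
structure Intervals (n : ℕ) where
  lo : Fin n → ℝ
  hi : Fin n → ℝ
  le : ∀ i, lo i ≤ hi i

/-- `v` is a possible vector of actual values. -/
def Intervals.Admits {n : ℕ} (I : Intervals n) (v : Fin n → ℝ) : Prop :=
  ∀ i, v i ∈ Set.Icc (I.lo i) (I.hi i)

/-- The intervals together with the values revealed so far: `known i = some x` if interval `i` has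
been queried with answer `x`, and `known i = none` if it has not been queried. -/
structure State (n : ℕ) where
  ivl : Intervals n
  known : Fin n → Option ℝ

namespace State

variable {n : ℕ}

/-- Left end of the current interval (`[x, x]` after a query with answer `x`). -/
def lo (s : State n) (i : Fin n) : ℝ := (s.known i).getD (s.ivl.lo i)

/-- Right end of the current interval. -/
def hi (s : State n) (i : Fin n) : ℝ := (s.known i).getD (s.ivl.hi i)

/-- The state after querying interval `i` with answer `x`. -/
def query (s : State n) (i : Fin n) (x : ℝ) : State n :=
  ⟨s.ivl, Function.update s.known i (some x)⟩

/-- The vector `u` agrees with everything known in state `s`. -/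
def Consistent (s : State n) (u : Fin n → ℝ) : Prop :=
  ∀ i, u i ∈ Set.Icc (s.lo i) (s.hi i)

/-- The dependency graph of the current intervals, with error threshold `δ`. -/
def depGraph (s : State n) (δ : ℝ) : SimpleGraph (Fin n) where
  Adj i j := i ≠ j ∧ δ < s.hi i - s.lo j ∧ δ < s.hi j - s.lo i
  symm := ⟨fun _ _ h => ⟨h.1.symm, h.2.2, h.2.1⟩⟩
  loopless := ⟨fun _ h => h.1 rfl⟩

/-- The current interval `i` contains `[a, b]` strictly on both sides. -/
def Contains (s : State n) (i : Fin n) (a b : ℝ) : Prop :=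
  s.lo i < a ∧ b < s.hi i

/-- Interval `i` satisfies the condition of the preprocessing loop. -/
def PreTest (s : State n) (δ : ℝ) (i : Fin n) : Prop :=
  (∃ j, s.Contains i (s.lo j - δ) (s.hi j + δ)) ∨
    ∃ j x, s.known j = some x ∧ s.Contains i (x - δ) (x + δ)

/-- Interval `i` satisfies the condition of the loop that ends each iteration. -/
def PostTest (s : State n) (δ : ℝ) (i : Fin n) : Prop :=
  ∃ j x, s.known j = some x ∧ s.Contains i (x - δ) (x + δ)

end State

/-- No interval has been queried. -/
def Intervals.start {n : ℕ} (I : Intervals n) : State n := ⟨I, fun _ => none⟩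

/-- The state in which exactly the intervals in `Q` have been queried, the actual values being
`v`. -/
def Intervals.reveal {n : ℕ} (I : Intervals n) (v : Fin n → ℝ) (Q : Finset (Fin n)) : State n :=
  ⟨I, fun i => if i ∈ Q then some (v i) else none⟩

/-- `π` (item `i` goes to position `π i`) sorts the values `u` up to the error threshold `δ`. -/
def Sorts {n : ℕ} (δ : ℝ) (π : Equiv.Perm (Fin n)) (u : Fin n → ℝ) : Prop :=
  ∀ i j, π i < π j → u i ≤ u j + δ

/-- Querying the set `Q` proves some order correct: one permutation sorts every vector of values
that is consistent with the intervals and with the answers to the queries in `Q`. -/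
def Sufficient {n : ℕ} (δ : ℝ) (I : Intervals n) (v : Fin n → ℝ) (Q : Finset (Fin n)) : Prop :=
  ∃ π : Equiv.Perm (Fin n), ∀ u, (I.reveal v Q).Consistent u → Sorts δ π u

/-- The size of an offline optimum query set. -/
def opt {n : ℕ} (δ : ℝ) (I : Intervals n) (v : Fin n → ℝ) : ℕ :=
  sInf {m | ∃ Q : Finset (Fin n), Sufficient δ I v Q ∧ Q.card = m}

/-! Deterministic adaptive algorithms. -/

/-- The behaviour of a deterministic adaptive algorithm on given intervals: finish, or query an
interval and continue depending on the answer. -/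
inductive QueryTree (n : ℕ) : Type
  | finish : QueryTree n
  | query (i : Fin n) (next : ℝ → QueryTree n) : QueryTree n

/-- The queries that are made, in order, when the actual values are `v`. -/
def QueryTree.queries {n : ℕ} (v : Fin n → ℝ) : QueryTree n → List (Fin n)
  | .finish => []
  | .query i next => i :: (next (v i)).queries v

/-- A deterministic adaptive algorithm (for every number of intervals, and given the intervals). -/
abbrev Algorithm := ∀ n : ℕ, Intervals n → QueryTree n

/-- The algorithm always stops with enough information to output a sorted order. -/
def Algorithm.Correct (A : Algorithm) (δ : ℝ) : Prop :=
  ∀ (n : ℕ) (I : Intervals n) (v : Fin n → ℝ), I.Admits v →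
    Sufficient δ I v ((A n I).queries v).toFinset

/-- On every instance in the class `P`, the algorithm makes at most `c` times as many queries as
an offline optimum query set. -/
def Algorithm.QueryCompetitive (A : Algorithm) (δ c : ℝ)
    (P : ∀ n : ℕ, Intervals n → (Fin n → ℝ) → Prop) : Prop :=
  ∀ (n : ℕ) (I : Intervals n) (v : Fin n → ℝ), I.Admits v → P n I v →
    (((A n I).queries v).length : ℝ) ≤ c * (opt δ I v : ℝ)

/-! Graph notions. -/

/-- `{i, j}` is a 2-component, that is, a connected component consisting of a single edge. -/
def IsTwoComponent {V : Type*} (G : SimpleGraph V) (i j : V) : Prop :=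
  i ≠ j ∧ ∃ C : G.ConnectedComponent, C.supp = {i, j}

def NoTwoComponents {V : Type*} (G : SimpleGraph V) : Prop :=
  ∀ i j, ¬ IsTwoComponent G i j

/-- `G` is the intersection graph of a family of closed intervals, none of which properly contains
another. -/
def IsProperIntervalGraph {V : Type*} (G : SimpleGraph V) : Prop :=
  ∃ a b : V → ℝ, (∀ u, a u ≤ b u) ∧
    (∀ u w, ¬ Set.Icc (a u) (b u) ⊂ Set.Icc (a w) (b w)) ∧
    ∀ u w, u ≠ w → (G.Adj u w ↔ (Set.Icc (a u) (b u) ∩ Set.Icc (a w) (b w)).Nonempty)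

/-! The algorithm. All choices that the pseudocode leaves open (which interval to query next in a
loop, which 2-component to treat and how to name its ends, ties between minima) are arbitrary. -/

/-- Points of the program. -/
inductive Point (n : ℕ) : Type
  /-- head of the preprocessing loop -/
  | pre : Point n
  /-- head of the main loop -/
  | main : Point n
  /-- the end `i` of the 2-component `{i, j}` has just been queried -/
  | pair (i j : Fin n) : Point n
  /-- `x`, `y`, `z` have been chosen and `y` has just been queried -/
  | triple (x y z : Fin n) : Point n
  /-- `z` is to be queried -/
  | third (z : Fin n) : Point n
  /-- head of the loop that ends an iteration of the main loop -/
  | post : Point n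
  | halt : Point n

/-- `x` is a non-isolated vertex with minimum right end. -/
def IsFirst {n : ℕ} (δ : ℝ) (s : State n) (x : Fin n) : Prop :=
  (∃ w, (s.depGraph δ).Adj x w) ∧
    ∀ x', (∃ w, (s.depGraph δ).Adj x' w) → s.hi x ≤ s.hi x'

/-- `y` is a neighbor of `x` with minimum right end. -/
def IsSecond {n : ℕ} (δ : ℝ) (s : State n) (x y : Fin n) : Prop :=
  (s.depGraph δ).Adj x y ∧ ∀ y', (s.depGraph δ).Adj x y' → s.hi y ≤ s.hi y'

/-- Given the neighbor `y` of `x`: `w` is another neighbor of `x`, or another neighbor of `y` in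
case that `y` is the only neighbor of `x`. -/
def IsThirdCandidate {n : ℕ} (δ : ℝ) (s : State n) (x y w : Fin n) : Prop :=
  w ≠ x ∧ w ≠ y ∧
    ((s.depGraph δ).Adj x w ∨
      ((∀ w', (s.depGraph δ).Adj x w' → w' = y) ∧ (s.depGraph δ).Adj y w))

/-- `z` is such a vertex with minimum right end. -/
def IsThird {n : ℕ} (δ : ℝ) (s : State n) (x y z : Fin n) : Prop :=
  IsThirdCandidate δ s x y z ∧ ∀ w, IsThirdCandidate δ s x y w → s.hi z ≤ s.hi w

/-- `Move δ p a s q b`: at point `a` in state `s`, the algorithm with coin parameter `p` may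
continue at point `b`, after querying interval `i` if `q = some i`, without any query if
`q = none`. -/
inductive Move {n : ℕ} (δ p : ℝ) : Point n → State n → Option (Fin n) → Point n → Prop
  | preQuery {s : State n} {i : Fin n} (h : s.PreTest δ i) : Move δ p .pre s (some i) .pre
  | preExit {s : State n} (h : ∀ i, ¬ s.PreTest δ i) : Move δ p .pre s none .main
  | mainExit {s : State n} (h : ∀ i j, ¬ (s.depGraph δ).Adj i j) : Move δ p .main s none .halt
  /-- the coin selects the first end `i` of the edge `ij` (probability `p`) -/
  | pickFirst {s : State n} {i j : Fin n} (hp : p ≠ 0) (h : IsTwoComponent (s.depGraph δ) i j) :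
      Move δ p .main s (some i) (.pair i j)
  /-- the coin selects the second end `j` of the edge `ij` (probability `1 - p`) -/
  | pickSecond {s : State n} {i j : Fin n} (hp : p ≠ 1) (h : IsTwoComponent (s.depGraph δ) i j) :
      Move δ p .main s (some j) (.pair j i)
  | pairQuery {s : State n} {i j : Fin n} (h : s.Contains j (s.lo i - δ) (s.hi i + δ)) :
      Move δ p (.pair i j) s (some j) .post
  | pairSkip {s : State n} {i j : Fin n} (h : ¬ s.Contains j (s.lo i - δ) (s.hi i + δ)) :
      Move δ p (.pair i j) s none .post
  | middle {s : State n} {x y z : Fin n} (hn : NoTwoComponents (s.depGraph δ))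
      (hx : IsFirst δ s x) (hy : IsSecond δ s x y) (hz : IsThird δ s x y z) :
      Move δ p .main s (some y) (.triple x y z)
  | tripleQuery {s : State n} {x y z : Fin n}
      (h : s.Contains x (s.lo y - δ) (s.hi y + δ) ∨ (s.depGraph δ).Adj x z) :
      Move δ p (.triple x y z) s (some x) (.third z)
  | tripleSkip {s : State n} {x y z : Fin n}
      (h : ¬ (s.Contains x (s.lo y - δ) (s.hi y + δ) ∨ (s.depGraph δ).Adj x z)) :
      Move δ p (.triple x y z) s none .post
  | thirdQuery {s : State n} {z : Fin n} : Move δ p (.third z) s (some z) .post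
  | postQuery {s : State n} {i : Fin n} (h : s.PostTest δ i) : Move δ p .post s (some i) .post
  | postExit {s : State n} (h : ∀ i, ¬ s.PostTest δ i) : Move δ p .post s none .main

/-- The tree is an execution of the algorithm from point `a` and state `s` on, for some way of
making the open choices and for all possible answers. -/
inductive Follows {n : ℕ} (δ p : ℝ) : Point n → State n → QueryTree n → Prop
  | halt {s : State n} : Follows δ p .halt s .finish
  | silent {a b : Point n} {s : State n} {T : QueryTree n} (h : Move δ p a s none b)
      (hT : Follows δ p b s T) : Follows δ p a s T
  | query {a b : Point n} {s : State n} {i : Fin n} {next : ℝ → QueryTree n}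
      (h : Move δ p a s (some i) b)
      (hT : ∀ x ∈ Set.Icc (s.lo i) (s.hi i), Follows δ p b (s.query i x) (next x)) :
      Follows δ p a s (.query i next)

/-- However the open choices are made and whatever the answers are, the execution from point `a`
and state `s` on reaches the end of the program after finitely many moves. -/
inductive Terminates {n : ℕ} (δ p : ℝ) : Point n → State n → Prop
  | halt {s : State n} : Terminates δ p .halt s
  | move {a : Point n} {s : State n} (hmove : ∃ q b, Move δ p a s q b)
      (hsilent : ∀ b, Move δ p a s none b → Terminates δ p b s)
      (hquery : ∀ i b, Move δ p a s (some i) b →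
        ∀ x ∈ Set.Icc (s.lo i) (s.hi i), Terminates δ p b (s.query i x)) :
      Terminates δ p a s

/-- `A` is the algorithm with coin parameter `p`, with some way of making the open choices. -/
def Implements (A : Algorithm) (δ p : ℝ) : Prop :=
  ∀ (n : ℕ) (I : Intervals n), Follows δ p .pre I.start (A n I)

/-- `t` is a final state of the preprocessing loop run from `s` with actual values `v`. -/
inductive PreResult {n : ℕ} (δ : ℝ) (v : Fin n → ℝ) : State n → State n → Prop
  | exit {s : State n} (h : ∀ i, ¬ s.PreTest δ i) : PreResult δ v s s
  | query {s t : State n} {i : Fin n} (h : s.PreTest δ i)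
      (ht : PreResult δ v (s.query i (v i)) t) : PreResult δ v s t

/-- The dependency graph has no 2-components after the preprocessing loop. -/
def NoTwoAfterPre (δ : ℝ) (n : ℕ) (I : Intervals n) (v : Fin n → ℝ) : Prop :=
  ∀ t, PreResult δ v I.start t → NoTwoComponents (t.depGraph δ)

/-- The dependency graph of the given intervals is a proper interval graph without 2-components,
and it has no 2-components after the preprocessing loop either. -/
def ProperNoTwo (δ : ℝ) (n : ℕ) (I : Intervals n) (v : Fin n → ℝ) : Prop :=
  IsProperIntervalGraph (I.start.depGraph δ) ∧ NoTwoComponents (I.start.depGraph δ) ∧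
    NoTwoAfterPre δ n I v

end UncertainSorting

end

/-!
For error threshold zero, a set of queries is sufficient if and only if the answers remove all
dependencies (`exists_sorts_iff`): two dependent intervals admit values in either order, and without
dependencies the order of the midpoints is correct. Hence a sufficient set `Q` contains an end of
each dependency and every interval that strictly contains a current interval
(`mem_or_mem_of_adj`, `mem_of_contains`). In particular the queries of the preprocessing loop and of
the loops that end the iterations are all in `Q`.

At the head of the main loop no interval strictly contains another one (`ContainFree`), so the
dependency graph is claw-free. Let `K` be the set of queries made so far. From the head of the main
loop on, three times the number of queries is at most `5 * #(Q \ K)` plus the number of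
2-components (`Follows.mainBound`), by induction over the iterations:

* A 2-component costs at most two queries, where `Q` needs one, and it disappears. If its first query
  is the only one, `Q` may have to be changed as in the second case below.
* Without 2-components, the algorithm queries `x`, `y`, `z`, and `Q` contains two of them; or it
  queries `y` only, and this answer makes the query of `x` superfluous, so that `Q` may be assumed
  to contain one interval less (`exists_sufficient_of_unique_adj`).
* A query of the loop that ends the iteration gives rise to at most two 2-components by
  claw-freeness (`card_twoComps_le`), which is less than what it gains. The queries of `x`, `y` and
  `z` give rise to at most one, since all remaining neighbors of these intervals contain the right
  end of `z`, hence depend on each other (`ContainFree.lo_lt_and_le_hi`).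

The algorithm terminates because no interval is queried twice.

For the lower bound, take two triangles with a common vertex `2` (`bowtie`). The value of the
interval `2` lies in no other interval. Of the two other intervals of each triangle, the one queried
first gets a value inside the other two intervals of the triangle, and the other one gets a value
inside no other interval. Then the algorithm has to query all five intervals, while the interval `2`
and the later interval of each triangle suffice.
-/

noncomputable section

namespace UncertainSorting

open Finset

variable {n : ℕ}

/-! ### States and dependency for error threshold zero -/

namespace State

lemma lo_le_hi (s : State n) (i : Fin n) : s.lo i ≤ s.hi i := by
  unfold lo hi
  cases s.known i
  · exact s.ivl.le i
  · exact le_rfl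

lemma adj_zero {s : State n} {i j : Fin n} :
    (s.depGraph 0).Adj i j ↔ i ≠ j ∧ s.lo j < s.hi i ∧ s.lo i < s.hi j := by
  simp [depGraph, sub_pos]

lemma Contains.known_eq_none {s : State n} {i : Fin n} {a b : ℝ} (h : s.Contains i a b)
    (hab : a ≤ b) : s.known i = none := by
  have hlt : s.lo i < s.hi i := h.1.trans_le (hab.trans h.2.le)
  unfold lo hi at hlt
  cases hk : s.known i with
  | none => rfl
  | some x => simp [hk] at hlt

lemma PostTest.known_eq_none {s : State n} {i : Fin n} (h : s.PostTest 0 i) :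
    s.known i = none := by
  obtain ⟨j, x, -, hc⟩ := h
  exact hc.known_eq_none (by simp)

lemma PreTest.known_eq_none {s : State n} {i : Fin n} (h : s.PreTest 0 i) :
    s.known i = none := by
  rcases h with ⟨j, hc⟩ | h
  · exact hc.known_eq_none (by simpa using s.lo_le_hi j)
  · exact PostTest.known_eq_none h

lemma lo_of_known {s : State n} {i : Fin n} {x : ℝ} (h : s.known i = some x) : s.lo i = x := by
  simp [lo, h]

lemma hi_of_known {s : State n} {i : Fin n} {x : ℝ} (h : s.known i = some x) : s.hi i = x := by
  simp [hi, h]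

/-- A revealed value can only depend on an interval that contains it in its interior, and such an
interval is queried by the loop that ends each iteration. -/
lemma known_eq_none_of_adj {s : State n} (hs : ∀ i, ¬ s.PostTest 0 i) {i j : Fin n}
    (h : (s.depGraph 0).Adj i j) : s.known i = none := by
  cases hk : s.known i with
  | none => rfl
  | some x =>
    rw [adj_zero, lo_of_known hk, hi_of_known hk] at h
    exact absurd ⟨i, x, hk, by simpa using h.2.1, by simpa using h.2.2⟩ (hs j)

/-- No current interval lies strictly inside another one. -/
def ContainFree (s : State n) : Prop := ∀ i j, ¬ s.Contains i (s.lo j) (s.hi j)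

/-- For error threshold zero the second condition of the preprocessing loop is a special case of
the first one. -/
lemma containFree_of_not_preTest {s : State n} (h : ∀ i, ¬ s.PreTest 0 i) : s.ContainFree :=
  fun i j hc => h i (.inl ⟨j, by simpa using hc⟩)

lemma ContainFree.not_postTest {s : State n} (h : s.ContainFree) (i : Fin n) :
    ¬ s.PostTest 0 i := by
  rintro ⟨j, x, hk, hc⟩
  refine h i j ?_
  simpa [lo_of_known hk, hi_of_known hk] using hc

/-- A single permutation sorts all consistent vectors of values if and only if there is no
dependency. -/
lemma exists_sorts_iff (s : State n) :
    (∃ π : Equiv.Perm (Fin n), ∀ u, s.Consistent u → Sorts 0 π u) ↔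
      ∀ i j, ¬ (s.depGraph 0).Adj i j := by
  constructor
  · rintro ⟨π, hπ⟩ i j hij
    -- Some consistent values put `a` strictly above `b`, so `π` cannot put `a` before `b`.
    have key : ∀ a b, (s.depGraph 0).Adj a b → ¬ π a < π b := by
      intro a b hab hlt
      rw [adj_zero] at hab
      have := hπ (fun k => if k = a then s.hi k else s.lo k) (fun k => by
        by_cases hk : k = a <;> simp [hk, s.lo_le_hi]) a b hlt
      simp [hab.1.symm] at this
      linarith [hab.2.1]
    rcases lt_trichotomy (π i) (π j) with h | h | h
    · exact key i j hij h
    · exact hij.ne (π.injective h)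
    · exact key j i hij.symm h
  · intro h
    -- Sort by the midpoints.
    let f : Fin n → ℝ := fun i => s.lo i + s.hi i
    refine ⟨(Tuple.sort f).symm, fun u hu i j hij => ?_⟩
    have hf : f i ≤ f j := by
      have := Tuple.monotone_sort f hij.le
      simpa using this
    have hi := hu i
    have hj := hu j
    have hne : i ≠ j := by
      rintro rfl
      exact lt_irrefl _ hij
    have hd := h i j
    rw [adj_zero] at hd
    simp only [Set.mem_Icc] at hi hj
    by_cases h1 : s.lo j < s.hi i
    · have h2 : s.hi j ≤ s.lo i := by
        by_contra h2
        exact hd ⟨hne, h1, not_le.mp h2⟩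
      simp only [f] at hf
      linarith
    · linarith

end State

open State

lemma sufficient_zero_iff {I : Intervals n} {v : Fin n → ℝ} {Q : Finset (Fin n)} :
    Sufficient 0 I v Q ↔ ∀ i j, ¬ ((I.reveal v Q).depGraph 0).Adj i j :=
  exists_sorts_iff _

section Reveal

variable {I : Intervals n} {v : Fin n → ℝ} {K K' Q : Finset (Fin n)} {i j : Fin n}

lemma reveal_empty : I.reveal v ∅ = I.start := by
  simp [Intervals.reveal, Intervals.start]

lemma reveal_query : (I.reveal v K).query i (v i) = I.reveal v (insert i K) := by
  simp only [State.query, Intervals.reveal, State.mk.injEq, true_and]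
  funext j
  by_cases hj : j = i
  · subst hj; simp
  · simp [hj]

lemma known_reveal_eq_none : (I.reveal v K).known i = none ↔ i ∉ K := by
  simp [Intervals.reveal]

lemma known_reveal_of_mem (h : i ∈ K) : (I.reveal v K).known i = some (v i) := by
  simp [Intervals.reveal, h]

lemma lo_reveal_of_mem (h : i ∈ K) : (I.reveal v K).lo i = v i :=
  lo_of_known (known_reveal_of_mem h)

lemma hi_reveal_of_mem (h : i ∈ K) : (I.reveal v K).hi i = v i :=
  hi_of_known (known_reveal_of_mem h)

lemma lo_reveal_of_notMem (h : i ∉ K) : (I.reveal v K).lo i = I.lo i := by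
  simp [State.lo, Intervals.reveal, h]

lemma hi_reveal_of_notMem (h : i ∉ K) : (I.reveal v K).hi i = I.hi i := by
  simp [State.hi, Intervals.reveal, h]

lemma consistent_reveal (hv : I.Admits v) : (I.reveal v K).Consistent v := by
  intro i
  by_cases h : i ∈ K
  · simp [lo_reveal_of_mem h, hi_reveal_of_mem h]
  · simpa [lo_reveal_of_notMem h, hi_reveal_of_notMem h] using hv i

lemma lo_le_lo_reveal (hv : I.Admits v) : I.lo i ≤ (I.reveal v K).lo i := by
  by_cases h : i ∈ K
  · simpa [lo_reveal_of_mem h] using (hv i).1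
  · simp [lo_reveal_of_notMem h]

lemma hi_reveal_le_hi (hv : I.Admits v) : (I.reveal v K).hi i ≤ I.hi i := by
  by_cases h : i ∈ K
  · simpa [hi_reveal_of_mem h] using (hv i).2
  · simp [hi_reveal_of_notMem h]

/-- Queries of other intervals do not affect a dependency. -/
lemma adj_reveal_congr (hi : i ∈ K ↔ i ∈ K') (hj : j ∈ K ↔ j ∈ K') :
    ((I.reveal v K).depGraph 0).Adj i j ↔ ((I.reveal v K').depGraph 0).Adj i j := by
  simp [adj_zero, State.lo, State.hi, Intervals.reveal, hi, hj]

/-- Queries can only remove dependencies. -/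
lemma adj_reveal_mono (hv : I.Admits v) (hi : i ∈ K → i ∈ K') (hj : j ∈ K → j ∈ K')
    (h : ((I.reveal v K').depGraph 0).Adj i j) : ((I.reveal v K).depGraph 0).Adj i j := by
  have key : ∀ k, (k ∈ K → k ∈ K') → (I.reveal v K).lo k ≤ (I.reveal v K').lo k ∧
      (I.reveal v K').hi k ≤ (I.reveal v K).hi k := by
    intro k hk
    by_cases hkK : k ∈ K
    · simp [lo_reveal_of_mem, hi_reveal_of_mem, hkK, hk hkK]
    · rw [lo_reveal_of_notMem hkK, hi_reveal_of_notMem hkK]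
      exact ⟨lo_le_lo_reveal hv, hi_reveal_le_hi hv⟩
  rw [adj_zero] at h ⊢
  exact ⟨h.1, by linarith [(key i hi).2, (key j hj).1], by linarith [(key i hi).1, (key j hj).2]⟩

/-- A sufficient set contains an end of every dependency that occurs at any time. -/
lemma mem_or_mem_of_adj (hv : I.Admits v) (hQ : Sufficient 0 I v Q)
    (h : ((I.reveal v K).depGraph 0).Adj i j) : i ∈ Q ∨ j ∈ Q := by
  by_contra! hc
  exact sufficient_zero_iff.mp hQ i j
    ((adj_reveal_congr (K := K ∩ Q) (by simp [hc.1]) (by simp [hc.2])).mp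
      (adj_reveal_mono hv (fun h => (mem_inter.mp h).1) (fun h => (mem_inter.mp h).1) h))

/-- A sufficient set contains every interval that at some time strictly contains another one. -/
lemma mem_of_contains (hv : I.Admits v) (hQ : Sufficient 0 I v Q)
    (h : (I.reveal v K).Contains i ((I.reveal v K).lo j) ((I.reveal v K).hi j)) : i ∈ Q := by
  by_contra hi
  have hne : i ≠ j := by
    rintro rfl
    exact lt_irrefl _ h.1
  have h1 := consistent_reveal (K := K) hv j
  have h2 := lo_le_lo_reveal (K := K) hv (i := i)
  have h3 := hi_reveal_le_hi (K := K) hv (i := i)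
  have h4 := consistent_reveal (K := Q) hv j
  have h5 := h.1
  have h6 := h.2
  simp only [Set.mem_Icc] at h1 h4
  refine sufficient_zero_iff.mp hQ i j ?_
  rw [adj_zero, lo_reveal_of_notMem hi, hi_reveal_of_notMem hi]
  exact ⟨hne, by linarith, by linarith⟩

lemma mem_of_postTest (hv : I.Admits v) (hQ : Sufficient 0 I v Q)
    (h : (I.reveal v K).PostTest 0 i) : i ∈ Q := by
  obtain ⟨j, x, hk, hc⟩ := h
  refine mem_of_contains (K := K) (j := j) hv hQ ?_
  simpa [lo_of_known hk, hi_of_known hk] using hc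

lemma mem_of_preTest (hv : I.Admits v) (hQ : Sufficient 0 I v Q)
    (h : (I.reveal v K).PreTest 0 i) : i ∈ Q := by
  rcases h with ⟨j, hc⟩ | h
  · exact mem_of_contains (K := K) (j := j) hv hQ (by simpa using hc)
  · exact mem_of_postTest hv hQ h

/-- Queries can only create containments of revealed values, so the loop that ends each iteration
removes all containments. -/
lemma State.ContainFree.of_subset (h : (I.reveal v K).ContainFree) (hKK : K ⊆ K')
    (hpost : ∀ i, ¬ (I.reveal v K').PostTest 0 i) : (I.reveal v K').ContainFree := by
  intro i j hc
  have hi : i ∉ K' := known_reveal_eq_none.mp (hc.known_eq_none (lo_le_hi _ j))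
  by_cases hj : j ∈ K'
  · refine hpost i ⟨j, v j, known_reveal_of_mem hj, ?_⟩
    simpa [lo_reveal_of_mem hj, hi_reveal_of_mem hj] using hc
  · refine h i j ?_
    have hi' : i ∉ K := fun h => hi (hKK h)
    have hj' : j ∉ K := fun h => hj (hKK h)
    simpa [Contains, lo_reveal_of_notMem, hi_reveal_of_notMem, hi, hj, hi', hj'] using hc

lemma State.ContainFree.notMem_of_adj (h : (I.reveal v K).ContainFree)
    (hij : ((I.reveal v K).depGraph 0).Adj i j) : i ∉ K :=
  known_reveal_eq_none.mp (known_eq_none_of_adj h.not_postTest hij)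

end Reveal

/-! ### Components consisting of a single edge -/

lemma isTwoComponent_iff {V : Type*} {G : SimpleGraph V} {i j : V} :
    IsTwoComponent G i j ↔
      G.Adj i j ∧ (∀ w, G.Adj i w → w = j) ∧ ∀ w, G.Adj j w → w = i := by
  constructor
  · rintro ⟨hne, C, hC⟩
    have hi : G.connectedComponentMk i = C := by
      have : i ∈ C.supp := by simp [hC]
      exact this
    have hj : G.connectedComponentMk j = C := by
      have : j ∈ C.supp := by simp [hC]
      exact this
    have key : ∀ a w, G.connectedComponentMk a = C → G.Adj a w → w = i ∨ w = j := by
      intro a w ha haw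
      have : w ∈ C.supp := by
        rw [SimpleGraph.ConnectedComponent.mem_supp_iff, ← ha]
        exact SimpleGraph.ConnectedComponent.sound haw.symm.reachable
      simpa [hC] using this
    have hi' : ∀ w, G.Adj i w → w = j := fun w hw =>
      (key i w hi hw).resolve_left fun h => hw.ne h.symm
    have hj' : ∀ w, G.Adj j w → w = i := fun w hw =>
      (key j w hj hw).resolve_right fun h => hw.ne h.symm
    refine ⟨?_, hi', hj'⟩
    obtain ⟨p⟩ := SimpleGraph.ConnectedComponent.exact (hi.trans hj.symm)
    cases p with
    | nil => exact absurd rfl hne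
    | cons h _ => exact hi' _ h ▸ h
  · rintro ⟨hij, hi, hj⟩
    refine ⟨hij.ne, G.connectedComponentMk i, ?_⟩
    ext w
    rw [SimpleGraph.ConnectedComponent.mem_supp_iff]
    constructor
    · intro h
      obtain ⟨p⟩ := SimpleGraph.ConnectedComponent.exact h.symm
      have : ∀ (a b : V), G.Walk a b → (a = i ∨ a = j) → (b = i ∨ b = j) := by
        intro a b q
        induction q with
        | nil => exact id
        | cons hadj _ ih =>
          rintro (rfl | rfl)
          · exact ih (.inr (hi _ hadj))
          · exact ih (.inl (hj _ hadj))
      simpa using this i w p (.inl rfl)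
    · rintro (rfl | rfl)
      · rfl
      · exact SimpleGraph.ConnectedComponent.sound hij.symm.reachable

/-- Distinct 2-components are disjoint, without edges in between. -/
lemma IsTwoComponent.separated {G : SimpleGraph (Fin n)} {p q : Fin n × Fin n}
    (hp : p.1 < p.2) (hq : q.1 < q.2) (hGp : IsTwoComponent G p.1 p.2)
    (hGq : IsTwoComponent G q.1 q.2) (hpq : p ≠ q) {e f : Fin n} (he : e = p.1 ∨ e = p.2)
    (hf : f = q.1 ∨ f = q.2) : e ≠ f ∧ ¬ G.Adj e f := by
  obtain ⟨a, b⟩ := p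
  obtain ⟨c, d⟩ := q
  rw [isTwoComponent_iff] at hGp hGq
  obtain ⟨hab, ha, hb⟩ := hGp
  obtain ⟨hcd, hc, hd⟩ := hGq
  simp only [ne_eq, Prod.mk.injEq, not_and] at *
  have disj : ∀ g, (g = a ∨ g = b) → (g = c ∨ g = d) → False := by
    rintro g (rfl | rfl) (rfl | rfl)
    · exact hpq rfl (ha _ hcd).symm
    · have := ha _ hcd.symm
      subst this
      exact lt_asymm hp hq
    · have := hb _ hcd
      subst this
      exact lt_asymm hp hq
    · have := hb _ hcd.symm
      exact hpq this.symm rfl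
  refine ⟨fun h => disj e he (h ▸ hf), fun h => disj f ?_ hf⟩
  rcases he with rfl | rfl
  · exact .inr (ha _ h)
  · exact .inl (hb _ h)

/-! ### Counting 2-components -/

open Classical in
/-- The 2-components of the current dependency graph, each with its ends in increasing order. -/
def twoComps (s : State n) : Finset (Fin n × Fin n) :=
  {c | c.1 < c.2 ∧ IsTwoComponent (s.depGraph 0) c.1 c.2}

lemma mem_twoComps {s : State n} {c : Fin n × Fin n} :
    c ∈ twoComps s ↔ c.1 < c.2 ∧ IsTwoComponent (s.depGraph 0) c.1 c.2 := by
  simp [twoComps]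

lemma twoComps_separated {s : State n} {c d : Fin n × Fin n} (hc : c ∈ twoComps s)
    (hd : d ∈ twoComps s) (hcd : c ≠ d) {e f : Fin n} (he : e = c.1 ∨ e = c.2)
    (hf : f = d.1 ∨ f = d.2) : e ≠ f ∧ ¬ (s.depGraph 0).Adj e f := by
  rw [mem_twoComps] at hc hd
  exact IsTwoComponent.separated hc.1 hd.1 hc.2 hd.2 hcd he hf

lemma isTwoComponent_symm {V : Type*} {G : SimpleGraph V} {i j : V} (h : IsTwoComponent G i j) :
    IsTwoComponent G j i := by
  rw [isTwoComponent_iff] at h ⊢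
  exact ⟨h.1.symm, h.2.2, h.2.1⟩

lemma exists_mem_twoComps {s : State n} {i j : Fin n}
    (h : IsTwoComponent (s.depGraph 0) i j) :
    ∃ c ∈ twoComps s, c = (i, j) ∨ c = (j, i) := by
  rcases lt_or_gt_of_ne h.1 with hij | hij
  · exact ⟨(i, j), mem_twoComps.mpr ⟨hij, h⟩, .inl rfl⟩
  · exact ⟨(j, i), mem_twoComps.mpr ⟨hij, isTwoComponent_symm h⟩, .inr rfl⟩

/-- Among three neighbors of an interval that does not strictly contain any other one, some two are
dependent: otherwise it would contain the middle one. -/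
lemma State.ContainFree.claw_free {s : State n} (hs : s.ContainFree) {w a b c : Fin n}
    (ha : (s.depGraph 0).Adj w a) (hb : (s.depGraph 0).Adj w b) (hc : (s.depGraph 0).Adj w c)
    (hab : a ≠ b) (hac : a ≠ c) (hbc : b ≠ c) :
    (s.depGraph 0).Adj a b ∨ (s.depGraph 0).Adj a c ∨ (s.depGraph 0).Adj b c := by
  by_contra! h
  simp only [adj_zero, not_and, not_lt] at ha hb hc h
  obtain ⟨h1, h2, h3⟩ := h
  have := s.lo_le_hi a
  have := s.lo_le_hi b
  have := s.lo_le_hi c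
  have Ha := hs w a
  have Hb := hs w b
  have Hc := hs w c
  simp only [Contains, not_and, not_lt] at Ha Hb Hc
  obtain ⟨-, ha1, ha2⟩ := ha
  obtain ⟨-, hb1, hb2⟩ := hb
  obtain ⟨-, hc1, hc2⟩ := hc
  have H1 : s.hi a ≤ s.lo b ∨ s.hi b ≤ s.lo a :=
    (le_or_gt (s.hi a) (s.lo b)).imp_right (h1 hab)
  have H2 : s.hi a ≤ s.lo c ∨ s.hi c ≤ s.lo a :=
    (le_or_gt (s.hi a) (s.lo c)).imp_right (h2 hac)
  have H3 : s.hi b ≤ s.lo c ∨ s.hi c ≤ s.lo b :=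
    (le_or_gt (s.hi b) (s.lo c)).imp_right (h3 hbc)
  rcases H1 with H1 | H1 <;> rcases H2 with H2 | H2 <;> rcases H3 with H3 | H3 <;>
  first
    | (have := Ha (by linarith); linarith)
    | (have := Hb (by linarith); linarith)
    | (have := Hc (by linarith); linarith)

section Counting

variable {I : Intervals n} {v : Fin n → ℝ} {K K₁ K' : Finset (Fin n)}

/-- Between intervals that are still unqueried, dependencies do not change. -/
lemma adj_of_adj_of_subset (hKK : K ⊆ K') {i j : Fin n} (hi : i ∉ K') (hj : j ∉ K')
    (h : ((I.reveal v K).depGraph 0).Adj i j) : ((I.reveal v K').depGraph 0).Adj i j :=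
  (adj_reveal_congr (iff_of_false (fun h => hi (hKK h)) hi)
    (iff_of_false (fun h => hj (hKK h)) hj)).mp h

lemma notMem_of_mem_twoComps (h' : (I.reveal v K').ContainFree) {c : Fin n × Fin n}
    (hc : c ∈ twoComps (I.reveal v K')) {e : Fin n} (he : e = c.1 ∨ e = c.2) : e ∉ K' := by
  have hadj := (isTwoComponent_iff.mp (mem_twoComps.mp hc).2).1
  rcases he with rfl | rfl
  · exact h'.notMem_of_adj hadj
  · exact h'.notMem_of_adj hadj.symm

open Classical in
/-- By claw-freeness, each query separates at most two 2-components. The bound counts this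
only for the queries outside `K₁`, and adds the 2-components that were adjacent to none of those. -/
lemma card_twoComps_le (h : (I.reveal v K).ContainFree) (h' : (I.reveal v K').ContainFree)
    (hKK : K ⊆ K') :
    #(twoComps (I.reveal v K')) ≤
      #{c ∈ twoComps (I.reveal v K') | ∀ w ∈ K' \ K₁, ∀ e, e = c.1 ∨ e = c.2 →
        ¬ ((I.reveal v K).depGraph 0).Adj w e} + #(K' \ K₁) * 2 := by
  set T := twoComps (I.reveal v K')
  set G := (I.reveal v K).depGraph 0
  let near : Fin n → Finset (Fin n × Fin n) := fun w =>
    {c ∈ T | ∃ e, (e = c.1 ∨ e = c.2) ∧ G.Adj w e}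
  have hnear : ∀ w, #(near w) ≤ 2 := by
    intro w
    by_contra! hcard
    obtain ⟨c, hc, d, hd, f, hf, hcd, hcf, hdf⟩ := two_lt_card.mp hcard
    simp only [near, mem_filter] at hc hd hf
    obtain ⟨hcT, a, ha, hwa⟩ := hc
    obtain ⟨hdT, b, hb, hwb⟩ := hd
    obtain ⟨hfT, g, hg, hwg⟩ := hf
    have sab := twoComps_separated hcT hdT hcd ha hb
    have sag := twoComps_separated hcT hfT hcf ha hg
    have sbg := twoComps_separated hdT hfT hdf hb hg
    have na := notMem_of_mem_twoComps h' hcT ha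
    have nb := notMem_of_mem_twoComps h' hdT hb
    have ng := notMem_of_mem_twoComps h' hfT hg
    rcases h.claw_free hwa hwb hwg sab.1 sag.1 sbg.1 with hadj | hadj | hadj
    · exact sab.2 (adj_of_adj_of_subset hKK na nb hadj)
    · exact sag.2 (adj_of_adj_of_subset hKK na ng hadj)
    · exact sbg.2 (adj_of_adj_of_subset hKK nb ng hadj)
  calc #T ≤ #({c ∈ T | ∀ w ∈ K' \ K₁, ∀ e, e = c.1 ∨ e = c.2 → ¬ G.Adj w e} ∪
        (K' \ K₁).biUnion near) := by
        refine card_le_card fun c hc => ?_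
        rw [mem_union, mem_biUnion]
        by_contra! hno
        refine hno.1 (mem_filter.mpr ⟨hc, fun w hw e he hadj => ?_⟩)
        exact hno.2 w hw (mem_filter.mpr ⟨hc, e, he, hadj⟩)
    _ ≤ _ := (card_union_le _ _).trans
        (Nat.add_le_add_left (card_biUnion_le_card_mul _ _ _ fun w _ => hnear w) _)

lemma exists_adj_of_mem_twoComps {s : State n} {c : Fin n × Fin n} (hc : c ∈ twoComps s)
    {e : Fin n} (he : e = c.1 ∨ e = c.2) :
    ∃ f, (f = c.1 ∨ f = c.2) ∧ (s.depGraph 0).Adj e f := by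
  have hadj := (isTwoComponent_iff.mp (mem_twoComps.mp hc).2).1
  rcases he with rfl | rfl
  · exact ⟨_, .inr rfl, hadj⟩
  · exact ⟨_, .inl rfl, hadj.symm⟩

/-- A 2-component that has not been there before was adjacent to a queried interval. -/
lemma mem_twoComps_or_exists_adj (hv : I.Admits v) (h : (I.reveal v K).ContainFree)
    (h' : (I.reveal v K').ContainFree) (hKK : K ⊆ K') {c : Fin n × Fin n}
    (hc : c ∈ twoComps (I.reveal v K')) :
    c ∈ twoComps (I.reveal v K) ∨ ∃ w ∈ K' \ K, ∃ e, (e = c.1 ∨ e = c.2) ∧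
      ((I.reveal v K).depGraph 0).Adj w e := by
  by_contra! hno
  refine hno.1 ?_
  have hc1 := notMem_of_mem_twoComps h' hc (.inl rfl)
  have hc2 := notMem_of_mem_twoComps h' hc (.inr rfl)
  have hw : ∀ w e, (e = c.1 ∨ e = c.2) → ((I.reveal v K).depGraph 0).Adj w e → w ∉ K' := by
    intro w e he hadj hwK
    exact hno.2 w (mem_sdiff.mpr ⟨hwK, h.notMem_of_adj hadj⟩) e he hadj
  rw [mem_twoComps, isTwoComponent_iff] at hc ⊢
  obtain ⟨hlt, hadj, hl, hr⟩ := hc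
  refine ⟨hlt, adj_reveal_mono hv (@hKK _) (@hKK _) hadj, fun w hcw => ?_, fun w hcw => ?_⟩
  · exact hl w (adj_of_adj_of_subset hKK hc1 (hw w _ (.inl rfl) hcw.symm) hcw)
  · exact hr w (adj_of_adj_of_subset hKK hc2 (hw w _ (.inr rfl) hcw.symm) hcw)

end Counting

lemma State.ContainFree.lo_lt_hi {s : State n} (hs : s.ContainFree) {i j : Fin n}
    (h : (s.depGraph 0).Adj i j) : s.lo i < s.hi i := by
  by_contra! hle
  have := adj_zero.mp h
  exact hs j i ⟨by linarith, by linarith⟩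

section Triple

variable {s : State n} {x y z : Fin n}

/-- The second and the third vertex are always dependent. -/
lemma IsThird.adj_second (hx : IsFirst 0 s x) (hy : IsSecond 0 s x y) (hz : IsThird 0 s x y z) :
    (s.depGraph 0).Adj y z := by
  rcases hz.1.2.2 with h | ⟨-, h⟩
  · have hxy := hx.2 y ⟨x, hy.1.symm⟩
    have hxz := hx.2 z ⟨x, h.symm⟩
    have hxy' := adj_zero.mp hy.1
    have hxz' := adj_zero.mp h
    exact adj_zero.mpr ⟨hz.1.2.1.symm, by linarith [hxz'.2.1], by linarith [hxy'.2.1]⟩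
  · exact h

/-- Every other interval that depends on one of the three chosen ones contains the right end of
`z`, in the sense that it starts before it and does not end before it. -/
lemma State.ContainFree.lo_lt_and_le_hi (hs : s.ContainFree) (hx : IsFirst 0 s x)
    (hy : IsSecond 0 s x y) (hz : IsThird 0 s x y z) {e w : Fin n} (hex : e ≠ x) (hey : e ≠ y)
    (hw : w = x ∨ w = y ∨ w = z) (h : (s.depGraph 0).Adj w e) :
    s.lo e < s.hi z ∧ s.hi z ≤ s.hi e := by
  have hyz := hz.adj_second hx hy
  have hxe := hx.2 e ⟨w, h.symm⟩
  have hxz := hx.2 z ⟨y, hyz.symm⟩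
  have Hxy := adj_zero.mp hy.1
  have Hyz := adj_zero.mp hyz
  have Hwe := adj_zero.mp h
  -- A non-isolated vertex that is not a neighbor of `x` starts after `x` has ended.
  have after : ∀ u, (∃ w, (s.depGraph 0).Adj u w) → u ≠ x → ¬ (s.depGraph 0).Adj x u →
      s.hi x ≤ s.lo u := by
    rintro u ⟨w, hu⟩ hux hxu
    by_contra! hlt
    have h1 := hx.2 u ⟨w, hu⟩
    exact hxu (adj_zero.mpr ⟨hux.symm, hlt, by linarith [hs.lo_lt_hi hy.1]⟩)
  have hzy : s.hi y ≤ s.hi z := by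
    by_cases hxz' : (s.depGraph 0).Adj x z
    · exact hy.2 z hxz'
    · have := after z ⟨y, hyz.symm⟩ hz.1.1 hxz'
      by_contra! hlt
      exact hs y z ⟨by linarith [Hxy.2.1], hlt⟩
  have hlt : s.lo e < s.hi z := by
    rcases hw with rfl | rfl | rfl
    · linarith [Hwe.2.1]
    · linarith [Hwe.2.1]
    · exact Hwe.2.1
  refine ⟨hlt, ?_⟩
  by_cases hcand : IsThirdCandidate 0 s x y e
  · exact hz.2 e hcand
  simp only [IsThirdCandidate, not_and_or, not_or, not_not] at hcand
  obtain ⟨hxe', hye⟩ := (hcand.resolve_left hex).resolve_left hey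
  have hlo := after e ⟨w, h.symm⟩ hex hxe'
  -- In both cases `z` starts before `e`, so it does not end after `e` either.
  have hze : s.lo z < s.lo e := by
    rcases hz.1.2.2 with hxz' | ⟨hxy, -⟩
    · linarith [(adj_zero.mp hxz').2.1]
    · have hye' : s.hi y ≤ s.lo e := by
        by_contra! hlt'
        exact hye.resolve_left (not_not_intro hxy) (adj_zero.mpr
          ⟨hey.symm, hlt', by linarith [Hxy.2.1, s.lo_le_hi e]⟩)
      linarith [Hyz.2.1]
  by_contra! hlt'
  exact hs z e ⟨hze, hlt'⟩

end Triple

/-! ### Termination -/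

/-- What is known about the state when the program reaches a point, as far as it is needed for
every query to be a query of an interval that has not been queried before. -/
def Invariant : Point n → State n → Prop
  | .main, s => ∀ i, ¬ s.PostTest 0 i
  | .triple x _ z, s => s.known x = none ∧ s.known z = none ∧ z ≠ x
  | .third z, s => s.known z = none
  | _, _ => True

/-- Moves without a query decrease the rank. -/
def rank : Point n → ℕ
  | .pre => 4
  | .main => 1
  | .pair _ _ => 3
  | .triple _ _ _ => 3
  | .third _ => 3
  | .post => 2
  | .halt => 0

/-- The number of intervals that have not been queried. -/
def unqueried (s : State n) : ℕ := #{i | s.known i = none}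

lemma unqueried_query_lt {s : State n} {i : Fin n} (h : s.known i = none) (x : ℝ) :
    unqueried (s.query i x) < unqueried s := by
  refine card_lt_card (ssubset_iff_of_subset (fun j hj => ?_) |>.mpr ⟨i, by simpa using h, ?_⟩)
  · rw [mem_filter_univ] at hj ⊢
    by_cases hji : j = i
    · exact hji ▸ h
    · simpa [State.query, hji] using hj
  · rw [mem_filter_univ]
    simp [State.query]

lemma known_query_of_ne {s : State n} {i j : Fin n} (h : j ≠ i) (x : ℝ) :
    (s.query i x).known j = s.known j := by
  simp [State.query, h]

lemma IsThird.adj {s : State n} {x y z : Fin n} (hz : IsThird 0 s x y z) :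
    ∃ w, (s.depGraph 0).Adj z w := by
  rcases hz.1.2.2 with h | ⟨-, h⟩
  · exact ⟨x, h.symm⟩
  · exact ⟨y, h.symm⟩

section Moves

variable {p : ℝ} {a b : Point n} {s : State n} {i : Fin n}

lemma Move.silent_invariant (h : Move 0 p a s none b) : Invariant b s ∧ rank b < rank a := by
  cases h with
  | preExit h => exact ⟨(containFree_of_not_preTest h).not_postTest, by simp [rank]⟩
  | postExit h => exact ⟨h, by simp [rank]⟩
  | mainExit h => exact ⟨trivial, by simp [rank]⟩
  | pairSkip h => exact ⟨trivial, by simp [rank]⟩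
  | tripleSkip h => exact ⟨trivial, by simp [rank]⟩

lemma Move.query_invariant (h : Move 0 p a s (some i) b) (ha : Invariant a s) :
    s.known i = none ∧ ∀ x, Invariant b (s.query i x) := by
  cases h with
  | preQuery h => exact ⟨h.known_eq_none, fun _ => trivial⟩
  | pickFirst hp h =>
    exact ⟨known_eq_none_of_adj ha (isTwoComponent_iff.mp h).1, fun _ => trivial⟩
  | pickSecond hp h =>
    exact ⟨known_eq_none_of_adj ha (isTwoComponent_iff.mp h).1.symm, fun _ => trivial⟩
  | pairQuery h =>
    exact ⟨h.known_eq_none (by simpa using s.lo_le_hi _), fun _ => trivial⟩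
  | middle hn hx hy hz =>
    obtain ⟨w, hw⟩ := hz.adj
    refine ⟨known_eq_none_of_adj ha hy.1.symm, fun t => ⟨?_, ?_, hz.1.1⟩⟩
    · rw [known_query_of_ne hy.1.ne]
      exact known_eq_none_of_adj ha hy.1
    · rw [known_query_of_ne hz.1.2.1]
      exact known_eq_none_of_adj ha hw
  | tripleQuery h =>
    obtain ⟨hx, hz, hzx⟩ := ha
    refine ⟨hx, fun t => ?_⟩
    change (s.query _ t).known _ = none
    rwa [known_query_of_ne hzx]
  | thirdQuery => exact ⟨ha, fun _ => trivial⟩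
  | postQuery h => exact ⟨h.known_eq_none, fun _ => trivial⟩

/-- Away from the end of the program some move is possible. In the main loop,
if there is no 2-component, then one of the ends `x`, `y` has another neighbor, so `z` exists. -/
lemma exists_move (p : ℝ) (s : State n) (ha : a ≠ .halt) : ∃ q b, Move 0 p a s q b := by
  cases a with
  | pre =>
    by_cases h : ∃ i, s.PreTest 0 i
    · exact ⟨_, _, .preQuery h.choose_spec⟩
    · exact ⟨_, _, .preExit (not_exists.mp h)⟩
  | post =>
    by_cases h : ∃ i, s.PostTest 0 i
    · exact ⟨_, _, .postQuery h.choose_spec⟩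
    · exact ⟨_, _, .postExit (not_exists.mp h)⟩
  | pair i j =>
    by_cases h : s.Contains j (s.lo i - 0) (s.hi i + 0)
    · exact ⟨_, _, .pairQuery h⟩
    · exact ⟨_, _, .pairSkip h⟩
  | triple x y z =>
    by_cases h : s.Contains x (s.lo y - 0) (s.hi y + 0) ∨ (s.depGraph 0).Adj x z
    · exact ⟨_, _, .tripleQuery h⟩
    · exact ⟨_, _, .tripleSkip h⟩
  | third z => exact ⟨_, _, .thirdQuery⟩
  | halt => exact absurd rfl ha
  | main =>
    by_cases hdep : ∀ i j, ¬ (s.depGraph 0).Adj i j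
    · exact ⟨_, _, .mainExit hdep⟩
    by_cases htwo : NoTwoComponents (s.depGraph 0)
    · push Not at hdep
      have exists_min : ∀ P : Fin n → Prop, (∃ i, P i) →
          ∃ i, P i ∧ ∀ j, P j → s.hi i ≤ s.hi j := by
        classical
        rintro P ⟨i, hi⟩
        obtain ⟨m, hm, hmin⟩ := exists_min_image (univ.filter P) s.hi ⟨i, by simpa using hi⟩
        exact ⟨m, by simpa using hm, fun j hj => hmin j (by simpa using hj)⟩
      obtain ⟨x, hx⟩ := exists_min _ hdep
      obtain ⟨y, hy⟩ := exists_min _ hx.1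
      obtain ⟨z, hz⟩ := exists_min (IsThirdCandidate 0 s x y) (by
        by_contra! hno
        refine htwo x y (isTwoComponent_iff.mpr ?_)
        have hxy : ∀ w, (s.depGraph 0).Adj x w → w = y := by
          intro w hw
          by_contra hwy
          exact hno w ⟨hw.ne', hwy, .inl hw⟩
        refine ⟨hy.1, hxy, fun w hw => ?_⟩
        by_contra hwx
        exact hno w ⟨hwx, hw.ne', .inr ⟨hxy, hw⟩⟩)
      exact ⟨_, _, .middle htwo hx hy hz⟩
    · simp only [NoTwoComponents, not_forall, not_not] at htwo
      obtain ⟨i, j, hij⟩ := htwo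
      by_cases hp : p = 0
      · exact ⟨_, _, .pickSecond (by simp [hp]) hij⟩
      · exact ⟨_, _, .pickFirst hp hij⟩

/-- The number of unqueried intervals decreases with every query, and the rank with every other
move. -/
lemma terminates_of_invariant (p : ℝ) (m : ℕ) :
    ∀ (a : Point n) (s : State n), 5 * unqueried s + rank a = m → Invariant a s →
      Terminates 0 p a s := by
  induction m using Nat.strong_induction_on with
  | _ m ih =>
    intro a s hm hinv
    by_cases ha : a = .halt
    · exact ha ▸ .halt
    refine .move (exists_move p s ha) (fun b hb => ?_) (fun i b hb x _ => ?_)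
    · obtain ⟨hinv', hrank⟩ := hb.silent_invariant
      exact ih _ (by omega) b s rfl hinv'
    · obtain ⟨hi, hinv'⟩ := hb.query_invariant hinv
      refine ih _ ?_ b _ rfl (hinv' x)
      have := unqueried_query_lt hi x
      have : rank b ≤ 4 := by cases b <;> simp [rank]
      omega

lemma Terminates.exists_follows {p : ℝ} (h : Terminates 0 p a s) :
    ∃ T, Follows 0 p a s T := by
  induction h with
  | halt => exact ⟨_, .halt⟩
  | @move a s hmove _ _ ihs ihq =>
    obtain ⟨q, b, hq⟩ := hmove
    cases q with
    | none =>
      obtain ⟨T, hT⟩ := ihs b hq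
      exact ⟨T, .silent hq hT⟩
    | some i =>
      have : ∀ x, ∃ T, x ∈ Set.Icc (s.lo i) (s.hi i) → Follows 0 p b (s.query i x) T := by
        intro x
        by_cases hx : x ∈ Set.Icc (s.lo i) (s.hi i)
        · obtain ⟨T, hT⟩ := ihq i b hq x hx
          exact ⟨T, fun _ => hT⟩
        · exact ⟨.finish, fun h => absurd h hx⟩
      choose next hnext using this
      exact ⟨_, .query hq hnext⟩

end Moves

theorem terminates_start (p : ℝ) (I : Intervals n) : Terminates 0 p .pre I.start :=
  terminates_of_invariant p _ _ _ rfl trivial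

theorem exists_implements (p : ℝ) : ∃ A : Algorithm, Implements A 0 p :=
  ⟨fun _ I => (terminates_start p I).exists_follows.choose,
    fun _ I => (terminates_start p I).exists_follows.choose_spec⟩

/-! ### Correctness -/

section Executions

variable {p : ℝ} {I : Intervals n} {v : Fin n → ℝ} {K Q : Finset (Fin n)}

lemma Follows.sufficient (hv : I.Admits v) {a : Point n} {s : State n} {T : QueryTree n}
    (h : Follows 0 p a s T) (hs : s = I.reveal v K)
    (ha : a = .halt → ∀ i j, ¬ (s.depGraph 0).Adj i j) :
    Sufficient 0 I v (K ∪ (T.queries v).toFinset) := by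
  induction h generalizing K with
  | halt => simpa [QueryTree.queries, sufficient_zero_iff, ← hs] using ha rfl
  | silent h _ ih =>
    refine ih hs ?_
    rintro rfl
    cases h with
    | mainExit h => exact h
  | @query a b s i next h _ ih =>
    subst hs
    have := ih (v i) (consistent_reveal hv i) reveal_query (by rintro rfl; cases h)
    simpa [QueryTree.queries] using this

theorem Implements.correct {A : Algorithm} (hA : Implements A 0 p) : A.Correct 0 := by
  intro n I v hv
  simpa using (hA n I).sufficient (K := ∅) hv reveal_empty.symm (by simp)

/-! ### The competitive ratio of the algorithm -/

lemma follows_halt {T : QueryTree n} {s : State n} (h : Follows 0 p .halt s T) : T = .finish := by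
  cases h with
  | halt => rfl
  | silent h _ => cases h
  | query h _ => cases h

/-- The loop that ends an iteration queries some members of `Q` and reaches the head of the main
loop. -/
lemma Follows.post (hv : I.Admits v) (hQ : Sufficient 0 I v Q) {T : QueryTree n}
    (h : Follows 0 p .post (I.reveal v K) T) :
    ∃ K' T', K ⊆ K' ∧ K' \ K ⊆ Q ∧ (∀ i, ¬ (I.reveal v K').PostTest 0 i) ∧
      Follows 0 p .main (I.reveal v K') T' ∧
      (T.queries v).length = #(K' \ K) + (T'.queries v).length := by
  generalize ha : Point.post = a at h
  generalize hs : I.reveal v K = s at h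
  induction h generalizing K with
  | halt => cases ha
  | @silent a b s T h hT ih =>
    subst ha hs
    cases h with
    | postExit h => exact ⟨K, T, Subset.rfl, by simp, h, hT, by simp⟩
  | @query a b s i next h hT ih =>
    subst ha hs
    cases h with
    | postQuery h =>
      obtain ⟨K', T', hKK, hQK, hp, hF, hlen⟩ :=
        ih (v i) (consistent_reveal hv i) rfl reveal_query.symm
      have hiK : i ∉ K := known_reveal_eq_none.mp h.known_eq_none
      have hiK' : i ∈ K' := hKK (mem_insert_self _ _)
      have hsd : K' \ K = insert i (K' \ insert i K) := by
        ext j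
        by_cases hj : j = i <;> simp [hj, hiK, hiK']
      refine ⟨K', T', (subset_insert _ _).trans hKK, ?_, hp, hF, ?_⟩
      · rw [hsd, insert_subset_iff]
        exact ⟨mem_of_postTest hv hQ h, hQK⟩
      · rw [hsd, card_insert_of_notMem (by simp)]
        simp only [QueryTree.queries, List.length_cons, hlen]
        omega

lemma card_sdiff_add_card {K₁ K' : Finset (Fin n)} (hKK : K₁ ⊆ K') (hQ : K' \ K₁ ⊆ Q) :
    #(Q \ K') + #(K' \ K₁) = #(Q \ K₁) := by
  rw [← card_union_of_disjoint]
  · congr 1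
    ext j
    have := @hKK j
    have := @hQ j
    simp only [mem_union, mem_sdiff] at *
    tauto
  · rw [disjoint_left]
    simp +contextual

lemma card_sdiff_lt {K₁ : Finset (Fin n)} {a : Fin n} (hKK : K ⊆ K₁) (ha : a ∈ Q) (haK : a ∉ K)
    (haK₁ : a ∈ K₁) : #(Q \ K₁) + 1 ≤ #(Q \ K) :=
  card_lt_card (ssubset_iff_of_subset (sdiff_subset_sdiff Subset.rfl hKK) |>.mpr
    ⟨a, by simp [ha, haK], by simp [haK₁]⟩)

lemma card_sdiff_add_two_le {K₁ : Finset (Fin n)} {a b : Fin n} (hKK : K ⊆ K₁) (hab : a ≠ b)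
    (ha : a ∈ Q) (haK : a ∉ K) (haK₁ : a ∈ K₁) (hb : b ∈ Q) (hbK : b ∉ K) (hbK₁ : b ∈ K₁) :
    #(Q \ K₁) + 2 ≤ #(Q \ K) := by
  have h1 := card_sdiff_lt (K := insert a K) (insert_subset haK₁ hKK) hb (by simp [hab.symm, hbK])
    hbK₁
  have h2 := card_sdiff_lt (subset_insert a K) ha haK (mem_insert_self _ _)
  omega

/-- If `i` is the only neighbor of `j` and its value does not force the query of `j`, then the query
of `i` is worth at least one query of a sufficient set: if this set contains `j`, but not `i`, then
after the query of `i` it does not need `j` any more. -/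
lemma exists_sufficient_of_unique_adj (hv : I.Admits v) (hQ : Sufficient 0 I v Q) {i j : Fin n}
    (hadj : ((I.reveal v K).depGraph 0).Adj i j) (hiK : i ∉ K) (hjK : j ∉ K)
    (hj : ∀ w, ((I.reveal v K).depGraph 0).Adj j w → w = i)
    (hcont : ¬ (I.lo j < v i ∧ v i < I.hi j)) :
    ∃ Q', Sufficient 0 I v Q' ∧ #(Q' \ insert i K) + 1 ≤ #(Q \ K) := by
  by_cases hiQ : i ∈ Q
  · exact ⟨Q, hQ, card_sdiff_lt (subset_insert _ _) hiQ hiK (mem_insert_self _ _)⟩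
  have hjQ : j ∈ Q := (mem_or_mem_of_adj hv hQ hadj).resolve_left hiQ
  refine ⟨(insert i K ∪ Q).erase j, sufficient_zero_iff.mpr ?_, ?_⟩
  · have hj' : ∀ b, ¬ ((I.reveal v ((insert i K ∪ Q).erase j)).depGraph 0).Adj j b := by
      intro b hb
      have hsub : ∀ k ∈ K, k ∈ (insert i K ∪ Q).erase j := by
        intro k hk
        have : k ≠ j := fun h => hjK (h ▸ hk)
        simp [this, hk]
      obtain rfl := hj b (adj_reveal_mono hv (hsub j) (hsub b) hb)
      have hmem : b ∈ (insert b K ∪ Q).erase j := by simp [hadj.ne]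
      rw [adj_zero, lo_reveal_of_mem hmem, hi_reveal_of_mem hmem, lo_reveal_of_notMem (by simp),
        hi_reveal_of_notMem (by simp)] at hb
      exact hcont ⟨hb.2.2, hb.2.1⟩
    intro a b hab
    by_cases ha : a = j
    · exact hj' b (ha ▸ hab)
    by_cases hb : b = j
    · exact hj' a (hb ▸ hab.symm)
    refine sufficient_zero_iff.mp hQ a b (adj_reveal_mono hv ?_ ?_ hab)
    · exact fun h => by simp [ha, h]
    · exact fun h => by simp [hb, h]
  · refine card_lt_card (ssubset_iff_of_subset ?_ |>.mpr ⟨j, by simp [hjQ, hjK], by simp⟩)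
    intro k
    simp only [mem_sdiff, mem_erase, mem_union]
    simp only [mem_insert]
    tauto

/-- The bound on the number of queries from the head of the main loop on: a 2-component may cost one
third of a query more than `5 / 3` times what the sufficient set `Q` spends on it. -/
def MainBound (I : Intervals n) (v : Fin n → ℝ) (Q K : Finset (Fin n)) (T : QueryTree n) : Prop :=
  3 * (T.queries v).length ≤ 5 * #(Q \ K) + #(twoComps (I.reveal v K))

open Classical in
/-- The loop at the end of an iteration that started in state `K` and has queried `K₁ \ K` so far.
Only the 2-components that no query of the loop has separated matter. -/
lemma Follows.length_post_le (hv : I.Admits v) (hQ : Sufficient 0 I v Q) {K₁ : Finset (Fin n)}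
    (hK : (I.reveal v K).ContainFree) (hKK₁ : K ⊆ K₁) {T : QueryTree n}
    (hT : Follows 0 p .post (I.reveal v K₁) T)
    (ih : ∀ K' T', K₁ ⊆ K' → (I.reveal v K').ContainFree →
      Follows 0 p .main (I.reveal v K') T' → MainBound I v Q K' T') {N : ℕ}
    (hN : ∀ K', K₁ ⊆ K' → (I.reveal v K').ContainFree →
      #{c ∈ twoComps (I.reveal v K') | ∀ w ∈ K' \ K₁, ∀ e, e = c.1 ∨ e = c.2 →
        ¬ ((I.reveal v K).depGraph 0).Adj w e} ≤ N) :
    3 * (T.queries v).length ≤ 5 * #(Q \ K₁) + N := by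
  obtain ⟨K', T', hKK', hQK, hpost, hT', hlen⟩ := hT.post hv hQ
  have hK' := hK.of_subset (hKK₁.trans hKK') hpost
  have h1 := ih K' T' hKK' hK' hT'
  have h2 := card_twoComps_le (K₁ := K₁) hK hK' (hKK₁.trans hKK')
  have h3 := hN K' hKK' hK'
  have h4 := card_sdiff_add_card hKK' hQK
  unfold MainBound at h1
  omega

/-- An iteration that treats the 2-component `{i, j}`, from the query of `i` on. -/
lemma Follows.length_pair_le (hv : I.Admits v) (hQ : Sufficient 0 I v Q)
    (hK : (I.reveal v K).ContainFree) {i j : Fin n}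
    (hij : IsTwoComponent ((I.reveal v K).depGraph 0) i j) {T : QueryTree n}
    (hT : Follows 0 p (.pair i j) (I.reveal v (insert i K)) T)
    (ih : ∀ Q' K' T', Sufficient 0 I v Q' → insert i K ⊆ K' → (I.reveal v K').ContainFree →
      Follows 0 p .main (I.reveal v K') T' → MainBound I v Q' K' T') :
    3 * ((T.queries v).length + 1) ≤ 5 * #(Q \ K) + #(twoComps (I.reveal v K)) := by
  classical
  obtain ⟨hadj, hi, hj⟩ := isTwoComponent_iff.mp hij
  have hiK := hK.notMem_of_adj hadj
  have hjK := hK.notMem_of_adj hadj.symm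
  obtain ⟨c₀, hc₀, hc₀'⟩ := exists_mem_twoComps hij
  -- The 2-component disappears and, except in the final loop, no new one arises.
  have hN : ∀ K₁, insert i K ⊆ K₁ → K₁ ⊆ insert j (insert i K) →
      ∀ K', K₁ ⊆ K' → (I.reveal v K').ContainFree →
      #{c ∈ twoComps (I.reveal v K') | ∀ w ∈ K' \ K₁, ∀ e, e = c.1 ∨ e = c.2 →
        ¬ ((I.reveal v K).depGraph 0).Adj w e} ≤ #(twoComps (I.reveal v K)) - 1 := by
    intro K₁ h1 h2 K' hKK' hK'
    have hKK : K ⊆ K' := (subset_insert _ _).trans (h1.trans hKK')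
    have hiK' : i ∈ K' := hKK' (h1 (mem_insert_self _ _))
    have hne : ∀ c ∈ twoComps (I.reveal v K'), ∀ e, e = c.1 ∨ e = c.2 → e ≠ i ∧ e ≠ j := by
      intro c hc e he
      refine ⟨?_, ?_⟩
      · rintro rfl
        exact notMem_of_mem_twoComps hK' hc he hiK'
      · rintro rfl
        obtain ⟨f, hf, hef⟩ := exists_adj_of_mem_twoComps hc he
        obtain rfl := hj f (adj_reveal_mono hv (@hKK _) (@hKK _) hef)
        exact notMem_of_mem_twoComps hK' hc hf hiK'
    rw [← card_erase_of_mem hc₀]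
    refine card_le_card fun c hc => ?_
    obtain ⟨hc, hfar⟩ := mem_filter.mp hc
    refine mem_erase.mpr ⟨?_, ?_⟩
    · rintro rfl
      rcases hc₀' with rfl | rfl
      · exact (hne _ hc i (.inl rfl)).1 rfl
      · exact (hne _ hc i (.inr rfl)).1 rfl
    · refine (mem_twoComps_or_exists_adj hv hK hK' hKK hc).resolve_right ?_
      rintro ⟨w, hw, e, he, hwe⟩
      rw [mem_sdiff] at hw
      have hwK₁ : w ∈ K₁ := by
        by_contra hwK₁
        exact hfar w (mem_sdiff.mpr ⟨hw.1, hwK₁⟩) e he hwe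
      have := h2 hwK₁
      simp only [mem_insert, hw.2, or_false] at this
      rcases this with rfl | rfl
      · exact (hne c hc e he).1 (hj e hwe)
      · exact (hne c hc e he).2 (hi e hwe)
  have hpos : 0 < #(twoComps (I.reveal v K)) := card_pos.mpr ⟨c₀, hc₀⟩
  have hjK' : j ∉ insert i K := by simp [hadj.ne', hjK]
  cases hT with
  | silent h hT =>
    cases h with
    | pairSkip h =>
      rw [Contains, lo_reveal_of_mem (mem_insert_self _ _), hi_reveal_of_mem (mem_insert_self _ _),
        lo_reveal_of_notMem hjK', hi_reveal_of_notMem hjK', sub_zero, add_zero] at h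
      obtain ⟨Q', hQ', hcard⟩ := exists_sufficient_of_unique_adj hv hQ hadj hiK hjK hj h
      have := hT.length_post_le hv hQ' hK (subset_insert _ _)
        (fun K' T' => ih Q' K' T' hQ') (hN _ Subset.rfl (subset_insert _ _))
      omega
  | @query _ b _ _ next h hT =>
    cases h with
    | pairQuery h =>
      have hT := hT (v j) (consistent_reveal hv j)
      rw [reveal_query] at hT
      have hsub : K ⊆ insert j (insert i K) := (subset_insert _ _).trans (subset_insert _ _)
      have := hT.length_post_le hv hQ hK hsub
        (fun K' T' h => ih Q K' T' hQ ((subset_insert _ _).trans h))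
        (hN _ (subset_insert _ _) Subset.rfl)
      have hcard : #(Q \ insert j (insert i K)) + 1 ≤ #(Q \ K) := by
        rcases mem_or_mem_of_adj hv hQ hadj with h | h
        · exact card_sdiff_lt hsub h hiK (by simp)
        · exact card_sdiff_lt hsub h hjK (by simp)
      simp only [QueryTree.queries, List.length_cons]
      omega

/-- An iteration that treats `x`, `y`, `z`, from the query of `y` on. -/
lemma Follows.length_triple_le (hv : I.Admits v) (hQ : Sufficient 0 I v Q)
    (hK : (I.reveal v K).ContainFree) (hn : NoTwoComponents ((I.reveal v K).depGraph 0))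
    {x y z : Fin n} (hx : IsFirst 0 (I.reveal v K) x) (hy : IsSecond 0 (I.reveal v K) x y)
    (hz : IsThird 0 (I.reveal v K) x y z) {T : QueryTree n}
    (hT : Follows 0 p (.triple x y z) (I.reveal v (insert y K)) T)
    (ih : ∀ Q' K' T', Sufficient 0 I v Q' → insert y K ⊆ K' → (I.reveal v K').ContainFree →
      Follows 0 p .main (I.reveal v K') T' → MainBound I v Q' K' T') :
    3 * ((T.queries v).length + 1) ≤ 5 * #(Q \ K) := by
  classical
  have hyz := hz.adj_second hx hy
  have hxK := hK.notMem_of_adj hy.1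
  have hyK := hK.notMem_of_adj hyz
  have hzK := hK.notMem_of_adj hyz.symm
  have hxy : x ≠ y := hy.1.ne
  have hxz : x ≠ z := hz.1.1.symm
  have hzy : z ≠ y := hz.1.2.1
  -- Except in the final loop at most one 2-component arises: its members that depended on `x`, `y`
  -- or `z` contain the right end of `z`.
  have hN : ∀ K₁, insert y K ⊆ K₁ → K₁ ⊆ insert z (insert x (insert y K)) →
      (x ∈ K₁ ∨ ∀ w, ((I.reveal v K).depGraph 0).Adj x w → w = y) →
      ∀ K', K₁ ⊆ K' → (I.reveal v K').ContainFree →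
      #{c ∈ twoComps (I.reveal v K') | ∀ w ∈ K' \ K₁, ∀ e, e = c.1 ∨ e = c.2 →
        ¬ ((I.reveal v K).depGraph 0).Adj w e} ≤ 1 := by
    intro K₁ h1 h2 hx₁ K' hKK' hK'
    have hKK : K ⊆ K' := (subset_insert _ _).trans (h1.trans hKK')
    have hyK' : y ∈ K' := hKK' (h1 (mem_insert_self _ _))
    have key : ∀ c ∈ twoComps (I.reveal v K'), (∀ w ∈ K' \ K₁, ∀ e, e = c.1 ∨ e = c.2 →
        ¬ ((I.reveal v K).depGraph 0).Adj w e) → ∃ e, (e = c.1 ∨ e = c.2) ∧ e ∉ K' ∧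
        (I.reveal v K).lo e < (I.reveal v K).hi z ∧
        (I.reveal v K).hi z ≤ (I.reveal v K).hi e := by
      intro c hc hfar
      obtain ⟨w, hw, e, he, hwe⟩ := (mem_twoComps_or_exists_adj hv hK hK' hKK hc).resolve_left
        fun h => hn _ _ (mem_twoComps.mp h).2
      have heK' := notMem_of_mem_twoComps hK' hc he
      rw [mem_sdiff] at hw
      have hwK₁ : w ∈ K₁ := by
        by_contra hwK₁
        exact hfar w (mem_sdiff.mpr ⟨hw.1, hwK₁⟩) e he hwe
      have hw' := h2 hwK₁
      simp only [mem_insert, hw.2, or_false] at hw'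
      have hex : e ≠ x := by
        rintro rfl
        rcases hx₁ with hx₁ | hx₁
        · exact heK' (hKK' hx₁)
        · obtain ⟨f, hf, hef⟩ := exists_adj_of_mem_twoComps hc he
          obtain rfl := hx₁ f (adj_reveal_mono hv (@hKK _) (@hKK _) hef)
          exact notMem_of_mem_twoComps hK' hc hf hyK'
      have hey : e ≠ y := by
        rintro rfl
        exact heK' hyK'
      exact ⟨e, he, heK', hK.lo_lt_and_le_hi hx hy hz hex hey (by tauto) hwe⟩
    refine card_le_one.mpr fun c hc d hd => ?_
    obtain ⟨hc, hcfar⟩ := mem_filter.mp hc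
    obtain ⟨hd, hdfar⟩ := mem_filter.mp hd
    obtain ⟨e, he, heK', he1, he2⟩ := key c hc hcfar
    obtain ⟨f, hf, hfK', hf1, hf2⟩ := key d hd hdfar
    by_contra hcd
    obtain ⟨hef, hnadj⟩ := twoComps_separated hc hd hcd he hf
    exact hnadj (adj_of_adj_of_subset hKK heK' hfK'
      (adj_zero.mpr ⟨hef, by linarith, by linarith⟩))
  have hxK' : x ∉ insert y K := by simp [hxy, hxK]
  have hadj : ((I.reveal v (insert y K)).depGraph 0).Adj x z ↔
      ((I.reveal v K).depGraph 0).Adj x z :=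
    adj_reveal_congr (by simp [hxy]) (by simp [hzy])
  cases hT with
  | silent h hT =>
    cases h with
    | tripleSkip h =>
      rw [not_or, hadj, Contains, lo_reveal_of_mem (mem_insert_self _ _),
        hi_reveal_of_mem (mem_insert_self _ _), lo_reveal_of_notMem hxK',
        hi_reveal_of_notMem hxK', sub_zero, add_zero] at h
      have hx' := (hz.1.2.2.resolve_left h.2).1
      obtain ⟨Q', hQ', hcard⟩ :=
        exists_sufficient_of_unique_adj hv hQ hy.1.symm hyK hxK hx' h.1
      have := hT.length_post_le hv hQ' hK (subset_insert _ _)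
        (fun K' T' => ih Q' K' T' hQ')
        (hN _ Subset.rfl ((subset_insert _ _).trans (subset_insert _ _)) (.inr hx'))
      omega
  | @query _ _ _ _ next h hT =>
    cases h with
    | tripleQuery h =>
      have hT := hT (v x) (consistent_reveal hv x)
      rw [reveal_query] at hT
      simp only [QueryTree.queries, List.length_cons]
      generalize next (v x) = T₂ at hT ⊢
      cases hT with
      | silent h' _ => cases h'
      | query h' hT =>
        cases h' with
        | thirdQuery =>
          have hT := hT (v z) (consistent_reveal hv z)
          rw [reveal_query] at hT
          have hsub₁ : insert y K ⊆ insert z (insert x (insert y K)) :=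
            (subset_insert _ _).trans (subset_insert _ _)
          have hsub := (subset_insert y K).trans hsub₁
          have := hT.length_post_le hv hQ hK hsub
            (fun K' T' h => ih Q K' T' hQ (hsub₁.trans h))
            (hN _ hsub₁ Subset.rfl (.inl (by simp)))
          -- Either the three vertices form a triangle, or the value of `y` forces the query of `x`.
          have hcard : #(Q \ insert z (insert x (insert y K))) + 2 ≤ #(Q \ K) := by
            have htwo : ∀ a b, a ≠ b → a ∈ Q → b ∈ Q → (a = x ∨ a = y ∨ a = z) →
                (b = x ∨ b = y ∨ b = z) →
                #(Q \ insert z (insert x (insert y K))) + 2 ≤ #(Q \ K) := by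
              intro a b hab ha hb ha' hb'
              refine card_sdiff_add_two_le hsub hab ha ?_ ?_ hb ?_ ?_
              · rcases ha' with rfl | rfl | rfl <;> assumption
              · rcases ha' with rfl | rfl | rfl <;> simp
              · rcases hb' with rfl | rfl | rfl <;> assumption
              · rcases hb' with rfl | rfl | rfl <;> simp
            have hyz' := mem_or_mem_of_adj hv hQ hyz
            have hxQ : x ∈ Q ∨ y ∈ Q ∧ z ∈ Q := by
              rcases h with h | h
              · exact .inl (mem_of_contains hv hQ (by simpa using h))
              · have h1 := mem_or_mem_of_adj hv hQ hy.1
                have h2 := mem_or_mem_of_adj hv hQ h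
                tauto
            rcases hxQ with hxQ | ⟨hyQ, hzQ⟩
            · rcases hyz' with hyQ | hzQ
              · exact htwo x y hxy hxQ hyQ (by simp) (by simp)
              · exact htwo x z hxz hxQ hzQ (by simp) (by simp)
            · exact htwo y z hzy.symm hyQ hzQ (by simp) (by simp)
          simp only [QueryTree.queries, List.length_cons]
          omega

lemma Follows.mainBound (hv : I.Admits v) {m : ℕ} :
    ∀ (Q K : Finset (Fin n)) (T : QueryTree n), #Kᶜ = m → Sufficient 0 I v Q →
      (I.reveal v K).ContainFree → Follows 0 p .main (I.reveal v K) T → MainBound I v Q K T := by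
  induction m using Nat.strong_induction_on with
  | _ m ih =>
    intro Q K T hm hQ hK hT
    have ih' : ∀ i ∉ K, ∀ Q' K' T', Sufficient 0 I v Q' → insert i K ⊆ K' →
        (I.reveal v K').ContainFree → Follows 0 p .main (I.reveal v K') T' →
        MainBound I v Q' K' T' := by
      intro i hi Q' K' T' hQ' hKK' hK' hT'
      refine ih _ ?_ Q' K' T' rfl hQ' hK' hT'
      have hlt : #K < #K' :=
        (card_lt_card (ssubset_insert hi)).trans_le (card_le_card hKK')
      have := card_le_univ K'
      rw [← hm, card_compl, card_compl]
      omega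
    unfold MainBound
    cases hT with
    | silent h hT =>
      cases h with
      | mainExit h => simp [follows_halt hT, QueryTree.queries]
    | @query _ b _ i next h hT =>
      have hT := hT (v i) (consistent_reveal hv i)
      rw [reveal_query] at hT
      simp only [QueryTree.queries, List.length_cons]
      cases h with
      | pickFirst hp h =>
        exact hT.length_pair_le hv hQ hK h
          (ih' _ (hK.notMem_of_adj (isTwoComponent_iff.mp h).1))
      | pickSecond hp h =>
        exact hT.length_pair_le hv hQ hK (isTwoComponent_symm h)
          (ih' _ (hK.notMem_of_adj (isTwoComponent_iff.mp h).1.symm))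
      | middle hn hx hy hz =>
        exact (hT.length_triple_le hv hQ hK hn hx hy hz
          (ih' _ (hK.notMem_of_adj hy.1.symm))).trans (Nat.le_add_right _ _)

/-- The preprocessing loop only queries members of `Q`. -/
lemma Follows.length_pre_le (hv : I.Admits v) (hQ : Sufficient 0 I v Q) {T : QueryTree n}
    (h : Follows 0 p .pre (I.reveal v K) T)
    (hno : ∀ t, PreResult 0 v (I.reveal v K) t → NoTwoComponents (t.depGraph 0)) :
    3 * (T.queries v).length ≤ 5 * #(Q \ K) := by
  generalize ha : Point.pre = a at h
  generalize hs : I.reveal v K = s at h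
  induction h generalizing K with
  | halt => cases ha
  | silent h hT ih =>
    subst ha hs
    cases h with
    | preExit h =>
      have hzero : twoComps (I.reveal v K) = ∅ :=
        eq_empty_of_forall_notMem fun c hc => hno _ (.exit h) _ _ (mem_twoComps.mp hc).2
      have := Follows.mainBound hv Q K _ rfl hQ (containFree_of_not_preTest h) hT
      simpa [MainBound, hzero] using this
  | @query a b s i next h hT ih =>
    subst ha hs
    cases h with
    | preQuery h =>
      have h1 := ih (v i) (consistent_reveal hv i) (K := insert i K)
        (fun t ht => hno t (.query h (reveal_query (I := I) (K := K) ▸ ht))) rfl reveal_query.symm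
      have h2 := card_sdiff_lt (subset_insert i K) (mem_of_preTest hv hQ h)
        (known_reveal_eq_none.mp h.known_eq_none) (mem_insert_self _ _)
      simp only [QueryTree.queries, List.length_cons]
      omega

theorem Implements.queryCompetitive {A : Algorithm} (hA : Implements A 0 p) :
    A.QueryCompetitive 0 (5 / 3) (NoTwoAfterPre 0) := by
  intro n I v hv hno
  have hne : {m | ∃ Q : Finset (Fin n), Sufficient 0 I v Q ∧ #Q = m}.Nonempty :=
    ⟨_, _, hA.correct n I v hv, rfl⟩
  obtain ⟨Q, hQ, hcard⟩ := Nat.sInf_mem hne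
  have hF := hA n I
  unfold NoTwoAfterPre at hno
  rw [← reveal_empty (v := v)] at hF hno
  have h := hF.length_pre_le hv hQ hno
  rw [sdiff_empty, hcard] at h
  have h' : (3 : ℝ) * ((A n I).queries v).length ≤ 5 * opt 0 I v := by exact_mod_cast h
  linarith

end Executions

/-! ### The lower bound -/

/-- The intervals `[0, 4], [0, 4], [2, 8], [6, 10], [6, 10]`, whose dependency graph consists of two
triangles with the common vertex `2`. -/
def bowtie : Intervals 5 where
  lo := ![0, 0, 2, 6, 6]
  hi := ![4, 4, 8, 10, 10]
  le := by
    intro i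
    fin_cases i <;> norm_num

/-- Values of `bowtie`. The value of interval `0` (if `σ`, otherwise of interval `1`) lies inside
both intervals `0` and `1`, so that it forces the query of the other one, whose own value is of no
use. In the same way, `τ` selects interval `3` or interval `4`. -/
def bowtieValues (σ τ : Bool) : Fin 5 → ℝ :=
  ![bif σ then 3 else 0, bif σ then 0 else 3, 5, bif τ then 7 else 10, bif τ then 10 else 7]

/-- The one of the intervals `0` and `1` selected by `σ`. -/
def leftEnd (σ : Bool) : Fin 5 := bif σ then 0 else 1

/-- The one of the intervals `3` and `4` selected by `τ`. -/
def rightEnd (τ : Bool) : Fin 5 := bif τ then 3 else 4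

lemma bowtie_admits (σ τ : Bool) : bowtie.Admits (bowtieValues σ τ) := by
  intro i
  cases σ <;> cases τ <;> fin_cases i <;> norm_num [bowtie, bowtieValues]

lemma exists_rightEnd_mem (σ : Bool) (T : QueryTree 5) :
    ∃ τ, rightEnd (!τ) ∈ T.queries (bowtieValues σ τ) →
      rightEnd τ ∈ T.queries (bowtieValues σ τ) := by
  induction T with
  | finish => exact ⟨true, by simp [QueryTree.queries]⟩
  | query i next ih =>
    by_cases h3 : i = 3
    · exact ⟨true, by simp [QueryTree.queries, rightEnd, h3]⟩
    by_cases h4 : i = 4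
    · exact ⟨false, by simp [QueryTree.queries, rightEnd, h4]⟩
    obtain ⟨τ, hτ⟩ := ih (bowtieValues σ true i)
    have hv : bowtieValues σ true i = bowtieValues σ τ i := by
      fin_cases i <;> first | rfl | simp at h3 h4
    rw [hv] at hτ
    refine ⟨τ, ?_⟩
    have hr : ∀ τ, rightEnd τ ≠ i := by
      intro τ
      cases τ
      · exact fun h => h4 h.symm
      · exact fun h => h3 h.symm
    simpa [QueryTree.queries, hr] using hτ

lemma exists_leftEnd_mem (τ : Bool) (T : QueryTree 5) :
    ∃ σ, leftEnd (!σ) ∈ T.queries (bowtieValues σ τ) →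
      leftEnd σ ∈ T.queries (bowtieValues σ τ) := by
  induction T with
  | finish => exact ⟨true, by simp [QueryTree.queries]⟩
  | query i next ih =>
    by_cases h0 : i = 0
    · exact ⟨true, by simp [QueryTree.queries, leftEnd, h0]⟩
    by_cases h1 : i = 1
    · exact ⟨false, by simp [QueryTree.queries, leftEnd, h1]⟩
    obtain ⟨σ, hσ⟩ := ih (bowtieValues true τ i)
    have hv : bowtieValues true τ i = bowtieValues σ τ i := by
      fin_cases i <;> first | rfl | simp at h0 h1
    rw [hv] at hσ
    refine ⟨σ, ?_⟩
    have hl : ∀ σ, leftEnd σ ≠ i := by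
      intro σ
      cases σ
      · exact fun h => h1 h.symm
      · exact fun h => h0 h.symm
    simpa [QueryTree.queries, hl] using hσ

/-- The adversary: `σ` and `τ` are fixed by the first query in each of the pairs `{0, 1}` and
`{3, 4}`, so the algorithm cannot query the other interval of a pair only. -/
lemma exists_ends_mem (T : QueryTree 5) :
    ∃ σ τ, (leftEnd (!σ) ∈ T.queries (bowtieValues σ τ) →
        leftEnd σ ∈ T.queries (bowtieValues σ τ)) ∧
      (rightEnd (!τ) ∈ T.queries (bowtieValues σ τ) →
        rightEnd τ ∈ T.queries (bowtieValues σ τ)) := by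
  induction T with
  | finish => exact ⟨true, true, by simp [QueryTree.queries]⟩
  | query i next ih =>
    have hleft : ∀ σ, leftEnd σ = i → ∃ σ τ,
        (leftEnd (!σ) ∈ (QueryTree.query i next).queries (bowtieValues σ τ) →
          leftEnd σ ∈ (QueryTree.query i next).queries (bowtieValues σ τ)) ∧
        (rightEnd (!τ) ∈ (QueryTree.query i next).queries (bowtieValues σ τ) →
          rightEnd τ ∈ (QueryTree.query i next).queries (bowtieValues σ τ)) := by
      rintro σ rfl
      obtain ⟨τ, hτ⟩ := exists_rightEnd_mem σ (next (bowtieValues σ true (leftEnd σ)))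
      have hv : bowtieValues σ true (leftEnd σ) = bowtieValues σ τ (leftEnd σ) := by
        cases σ <;> rfl
      have hne : ∀ τ, rightEnd τ ≠ leftEnd σ := by
        intro τ
        cases σ <;> cases τ <;> decide
      rw [hv] at hτ
      exact ⟨σ, τ, by simp [QueryTree.queries], by simpa [QueryTree.queries, hne] using hτ⟩
    have hright : ∀ τ, rightEnd τ = i → ∃ σ τ,
        (leftEnd (!σ) ∈ (QueryTree.query i next).queries (bowtieValues σ τ) →
          leftEnd σ ∈ (QueryTree.query i next).queries (bowtieValues σ τ)) ∧
        (rightEnd (!τ) ∈ (QueryTree.query i next).queries (bowtieValues σ τ) →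
          rightEnd τ ∈ (QueryTree.query i next).queries (bowtieValues σ τ)) := by
      rintro τ rfl
      obtain ⟨σ, hσ⟩ := exists_leftEnd_mem τ (next (bowtieValues true τ (rightEnd τ)))
      have hv : bowtieValues true τ (rightEnd τ) = bowtieValues σ τ (rightEnd τ) := by
        cases τ <;> rfl
      have hne : ∀ σ, leftEnd σ ≠ rightEnd τ := by
        intro σ
        cases σ <;> cases τ <;> decide
      rw [hv] at hσ
      exact ⟨σ, τ, by simpa [QueryTree.queries, hne] using hσ, by simp [QueryTree.queries]⟩
    by_cases h0 : leftEnd true = i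
    · exact hleft _ h0
    by_cases h1 : leftEnd false = i
    · exact hleft _ h1
    by_cases h3 : rightEnd true = i
    · exact hright _ h3
    by_cases h4 : rightEnd false = i
    · exact hright _ h4
    obtain ⟨σ, τ, hσ, hτ⟩ := ih 5
    have hv : bowtieValues σ τ i = 5 := by
      fin_cases i <;> first | rfl | simp [leftEnd, rightEnd] at h0 h1 h3 h4
    have hl : ∀ σ, leftEnd σ ≠ i := by
      intro σ
      cases σ
      · exact h1
      · exact h0
    have hr : ∀ τ, rightEnd τ ≠ i := by
      intro τ
      cases τ
      · exact h4
      · exact h3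
    refine ⟨σ, τ, ?_, ?_⟩
    · simpa [QueryTree.queries, hv, hl] using hσ
    · simpa [QueryTree.queries, hv, hr] using hτ

lemma bowtie_sufficient (σ τ : Bool) :
    Sufficient 0 bowtie (bowtieValues σ τ) {2, leftEnd (!σ), rightEnd (!τ)} := by
  rw [sufficient_zero_iff]
  intro i j
  rw [adj_zero]
  cases σ <;> cases τ <;> fin_cases i <;> fin_cases j <;>
    simp [State.lo, State.hi, Intervals.reveal, bowtie, bowtieValues, leftEnd, rightEnd] <;>
    norm_num

/-- Every sufficient set for these values contains the common vertex of the triangles and, of each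
of the two pairs, the interval that is not selected. -/
lemma subset_of_bowtie_sufficient {σ τ : Bool} {Q : Finset (Fin 5)}
    (h : Sufficient 0 bowtie (bowtieValues σ τ) Q) :
    2 ∈ Q ∧ leftEnd (!σ) ∈ Q ∧ rightEnd (!τ) ∈ Q := by
  have hv := bowtie_admits σ τ
  -- An interval containing the value of another one in its interior has to be queried.
  have key : ∀ i j, bowtie.lo i < bowtieValues σ τ j → bowtieValues σ τ j < bowtie.hi i →
      i ≠ j → i ∈ Q := by
    intro i j h1 h2 hij
    refine mem_of_contains (K := {j}) (j := j) hv h ?_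
    simpa [Contains, lo_reveal_of_mem, hi_reveal_of_mem, lo_reveal_of_notMem,
      hi_reveal_of_notMem, hij] using ⟨h1, h2⟩
  refine ⟨key 2 (leftEnd σ) ?_ ?_ ?_, key _ (leftEnd σ) ?_ ?_ ?_, key _ (rightEnd τ) ?_ ?_ ?_⟩ <;>
    cases σ <;> cases τ <;> simp [bowtie, bowtieValues, leftEnd, rightEnd] <;> norm_num

lemma adj_bowtie {i j : Fin 5} :
    (bowtie.start.depGraph 0).Adj i j ↔ i ≠ j ∧ bowtie.lo j < bowtie.hi i ∧
      bowtie.lo i < bowtie.hi j := by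
  rw [adj_zero]
  rfl

lemma bowtie_noTwoComponents : NoTwoComponents (bowtie.start.depGraph 0) := by
  intro i j h
  rw [isTwoComponent_iff] at h
  have key : ∀ a b, a ≠ b → (bowtie.start.depGraph 0).Adj i a →
      ¬ (bowtie.start.depGraph 0).Adj i b :=
    fun a b hab ha hb => hab ((h.2.1 a ha).trans (h.2.1 b hb).symm)
  simp only [adj_bowtie] at key
  fin_cases i
  · exact key 1 2 (by decide) (by simp [bowtie]) (by simp [bowtie]; norm_num)
  · exact key 0 2 (by decide) (by simp [bowtie]) (by simp [bowtie]; norm_num)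
  · exact key 0 1 (by decide) (by simp [bowtie]; norm_num) (by simp [bowtie]; norm_num)
  · exact key 2 4 (by decide) (by simp [bowtie]; norm_num) (by simp [bowtie]; norm_num)
  · exact key 2 3 (by decide) (by simp [bowtie]; norm_num) (by simp [bowtie]; norm_num)

lemma bowtie_properNoTwo (σ τ : Bool) : ProperNoTwo 0 5 bowtie (bowtieValues σ τ) := by
  refine ⟨⟨bowtie.lo, bowtie.hi, bowtie.le, ?_, ?_⟩, bowtie_noTwoComponents, ?_⟩
  · intro u w h
    have h1 := (Set.Icc_subset_Icc_iff (bowtie.le u)).mp h.1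
    refine h.2 (Set.Icc_subset_Icc ?_ ?_) <;> revert h1 <;>
      fin_cases u <;> fin_cases w <;> norm_num [bowtie]
  · intro u w huw
    rw [adj_bowtie, Set.Icc_inter_Icc, Set.nonempty_Icc]
    revert huw
    fin_cases u <;> fin_cases w <;> norm_num [bowtie]
  · -- The preprocessing loop makes no query.
    intro t ht
    have hpre : ∀ i, ¬ bowtie.start.PreTest 0 i := by
      rintro i (⟨j, h⟩ | ⟨j, x, h, -⟩)
      · revert h
        fin_cases i <;> fin_cases j <;>
          norm_num [Contains, State.lo, State.hi, Intervals.start, bowtie]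
      · simp [Intervals.start] at h
    cases ht with
    | exit _ => exact bowtie_noTwoComponents
    | query h _ => exact absurd h (hpre _)

theorem five_thirds_le {A : Algorithm} (hA : A.Correct 0) {c : ℝ}
    (hc : A.QueryCompetitive 0 c (ProperNoTwo 0)) : 5 / 3 ≤ c := by
  obtain ⟨σ, τ, hσ, hτ⟩ := exists_ends_mem (A 5 bowtie)
  have hcomp := hc 5 bowtie _ (bowtie_admits σ τ) (bowtie_properNoTwo σ τ)
  obtain ⟨h2, hl, hr⟩ := subset_of_bowtie_sufficient (hA 5 bowtie _ (bowtie_admits σ τ))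
  set L := (A 5 bowtie).queries (bowtieValues σ τ)
  rw [List.mem_toFinset] at h2 hl hr
  have hL : L.toFinset = univ := by
    have hl' := hσ hl
    have hr' := hτ hr
    ext i
    cases σ <;> cases τ <;> simp only [leftEnd, rightEnd, Bool.not_true, Bool.not_false, cond_true,
      cond_false] at hl hr hl' hr' <;> fin_cases i <;> simpa
  have hlen : 5 ≤ L.length := by
    have := L.toFinset_card_le
    simpa [hL] using this
  have hopt : opt 0 bowtie (bowtieValues σ τ) ≤ 3 := by
    refine le_trans (Nat.sInf_le ⟨_, bowtie_sufficient σ τ, rfl⟩) card_le_three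
  have hlen' : (5 : ℝ) ≤ L.length := by exact_mod_cast hlen
  have hopt' : (opt 0 bowtie (bowtieValues σ τ) : ℝ) ≤ 3 := by exact_mod_cast hopt
  have hopt0 : (0 : ℝ) ≤ opt 0 bowtie (bowtieValues σ τ) := Nat.cast_nonneg _
  by_contra! hlt
  have hle := mul_le_mul_of_nonneg_right hlt.le hopt0
  have h3 : (opt 0 bowtie (bowtieValues σ τ) : ℝ) = 3 := by linarith
  rw [h3] at hcomp
  linarith

end UncertainSorting

end

theorem mainTheorem2 :
    (∀ p : ℝ, p = 0 ∨ p = 1 →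
      (∀ (n : ℕ) (I : UncertainSorting.Intervals n),
        UncertainSorting.Terminates 0 p UncertainSorting.Point.pre I.start) ∧
      (∃ A : UncertainSorting.Algorithm, UncertainSorting.Implements A 0 p) ∧
      (∀ A : UncertainSorting.Algorithm, UncertainSorting.Implements A 0 p →
        A.Correct 0 ∧ A.QueryCompetitive 0 (5 / 3) (UncertainSorting.NoTwoAfterPre 0))) ∧
    (∀ A : UncertainSorting.Algorithm, A.Correct 0 →
      ∀ c : ℝ, A.QueryCompetitive 0 c (UncertainSorting.ProperNoTwo 0) → 5 / 3 ≤ c) :=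
  ⟨fun p _ => ⟨fun _ I => UncertainSorting.terminates_start p I,
    UncertainSorting.exists_implements p, fun _ hA => ⟨hA.correct, hA.queryCompetitive⟩⟩,
    fun _ hA _ hc => UncertainSorting.five_thirds_le hA hc⟩
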